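/- **Setting.** Let $\mathcal F^2$ be the Fock space of entire functions $f$ with $\frac1\pi\int_{\mathbb C}|f(z)|^2e^{-|z|^2}\,dV(z)<\infty$, with inner product $\langle f,g\rangle=\frac1\pi\int_{\mathbb C} f(z)\overline{g(z)}e^{-|z|^2}\,dV(z)$. Let $a,b,c\in\mathbb C$ satisfy $|a|=1$, $\bar ab+\bar b=0$, $|c|^2e^{|b|^2}=1$, and let $\mathcal C_{a,b,c}$ be the conjugation $\mathcal C_{a,b,c}f(z)=ce^{bz}\overline{f(\overline{az+b})}$ of $\mathcal F^2$. For a conjugation $\mathcal C$, an operator $A$ is *$\mathcal C$-symmetric* if $\langle\mathcal Cx,Ay\rangle=\langle\mathcal CAx,y\rangle$ for all $x,y\in\operatorname{dom}(A)$, and *$\mathcal C$-selfadjoint* if it is densely defined and $A=\mathcal CA^*\mathcal C$. For a family $T=(T(t))_{t\ge0}$ of (unbounded) linear operators on a Hilbert space, let $\mathfrak D(T)$ be the set of all $x\in\bigcap_{t,s\ge0}\operatorname{dom}(T(t)T(s))$ such that $T(t)T(s)x=T(t+s)x$ for all $t,s\ge0$, $t\mapsto T(t)x$ is continuous on $(0,\infty)$,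 and $\lim_{t\to0^+}\|T(t)x-x\|=0$. The family is an *unbounded $C_0$-semigroup* if $\mathfrak D(T)\ne\{0\}$. For $\omega\in\mathbb R$ put $\Sigma_\omega=\{x\in\mathfrak D(T):\sup_{t\ge0}e^{-\omega t}\|T(t)x\|<\infty\}$. The *generator* of $T$ is the operator $A$ whose domain consists of all $x=\int_0^\infty e^{-\lambda t}T(t)y\,dt$ with $\omega\in\mathbb R$, $\operatorname{Re}\lambda>\omega$, $y\in\Sigma_\omega$, and $Ax=\lambda x-y$ for such $x$. **Statement.** Let $\ell,G,H\in\mathbb C$, $\ell\ne0$, and for $t\ge0$ let $$\zeta_t(z)=e^{\ell t}z+G(1-e^{\ell t}),\qquad \xi_t(z)=\exp\!\big[Ht+G(aG+b)(e^{\ell t}-\ell t-1)\big]\,e^{z(aG+b)(1-e^{\ell t})}.$$ Let $W=(W(t))_{t\ge0}$ be an unbounded $C_0$-semigroup on $\mathcal F^2$ such that each $W(t)$ is a $\mathcal C_{a,b,c}$-selfadjoint operator with $W(t)f=\xi_t\cdot(f\circ\zeta_t)$ for all $f\in\operatorname{dom}(W(t))$, where $\operatorname{dom}(W(t))\subseteq\{f\in\mathcal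 F^2:\xi_t\cdot(f\circ\zeta_t)\in\mathcal F^2\}$. Then: 1. $W$ has a generator $R$, and it is given by $$\operatorname{dom}(R)=\bigcup_{\omega\in\mathbb R}\{f\in\Sigma_\omega:[H-\ell(aG+b)z]f+\ell(z-G)f'\in\Sigma_\omega\},$$ $$Rf(z)=[H-\ell(aG+b)z]f(z)+\ell(z-G)f'(z)\qquad(f\in\operatorname{dom}(R),\ z\in\mathbb C).$$ 2. $R$ is $\mathcal C_{a,b,c}$-symmetric. 3. If $\ell$ is real with $\ell>0$ and $aG+b\ne0$, then $R$ is densely defined (so $R^*$ exists), $R$ is not $\mathcal C_{a,b,c}$-selfadjoint, and the adjoint family $(W(t)^*)_{t\ge0}$ is an unbounded $C_0$-semigroup that has a generator, but $R^*$ is not its generator. 4. The point spectrum satisfies $\sigma_p(R)\subseteq\{H-\ell(aG+b)G+k\ell:k\in\mathbb N\}$, where $\mathbb N=\{0,1,2,\dots\}$. -/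

import Mathlib

open MeasureTheory Complex
open scoped ComplexConjugate Topology

noncomputable section

namespace CSym

/-! ## The Fock space -/

/-- The Gaussian measure `π⁻¹ e^{-|z|²} dV(z)` on the complex plane. -/
def gaussian : Measure ℂ :=
  (volume : Measure ℂ).withDensity fun z => ENNReal.ofReal (Real.pi⁻¹ * Real.exp (-‖z‖ ^ 2))

/-- `f` is an entire function that is square integrable for the Gaussian measure. -/
def MemFock (f : ℂ → ℂ) : Prop :=
  Differentiable ℂ f ∧ MemLp f 2 gaussian

/-- The entire functions in the Fock space, as a linear subspace of all functions. -/
def fockSubmodule : Submodule ℂ (ℂ → ℂ) where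
  carrier := {f | MemFock f}
  add_mem' hf hg := ⟨hf.1.add hg.1, hf.2.add hg.2⟩
  zero_mem' := ⟨differentiable_const 0, MemLp.zero⟩
  smul_mem' c _ hf := ⟨hf.1.const_smul c, hf.2.const_smul c⟩

/-- The Fock space. -/
def Fock : Type := fockSubmodule

namespace Fock

instance : AddCommGroup Fock := inferInstanceAs (AddCommGroup fockSubmodule)

instance : Module ℂ Fock := inferInstanceAs (Module ℂ fockSubmodule)

instance : FunLike Fock ℂ ℂ where
  coe f := f.1
  coe_injective _ _ h := Subtype.ext h

/-- An element of the Fock space from an entire function and its square integrability. -/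
def mk (f : ℂ → ℂ) (hf : MemFock f) : Fock := ⟨f, hf⟩

@[simp] theorem mk_apply (f : ℂ → ℂ) (hf : MemFock f) (z : ℂ) : mk f hf z = f z := rfl

@[simp] theorem add_apply (f g : Fock) (z : ℂ) : (f + g) z = f z + g z := rfl

@[simp] theorem smul_apply (c : ℂ) (f : Fock) (z : ℂ) : (c • f) z = c * f z := rfl

@[simp] theorem sub_apply (f g : Fock) (z : ℂ) : (f - g) z = f z - g z := rfl

@[simp] theorem zero_apply (z : ℂ) : (0 : Fock) z = 0 := rfl

@[ext] theorem ext {f g : Fock} (h : ∀ z, f z = g z) : f = g := DFunLike.ext f g h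

theorem differentiable (f : Fock) : Differentiable ℂ f := f.2.1

theorem memLp (f : Fock) : MemLp f 2 gaussian := f.2.2

theorem measurable_dens :
    Measurable fun z : ℂ => ENNReal.ofReal (Real.pi⁻¹ * Real.exp (-‖z‖ ^ 2)) := by
  fun_prop

theorem dens_pos (z : ℂ) : 0 < Real.pi⁻¹ * Real.exp (-‖z‖ ^ 2) := by positivity

theorem volume_ac : (volume : Measure ℂ) ≪ gaussian :=
  withDensity_absolutelyContinuous' measurable_dens.aemeasurable
    (Filter.Eventually.of_forall fun z => by simpa using dens_pos z)

theorem eq_of_ae {f g : ℂ → ℂ} (hf : Continuous f) (hg : Continuous g)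
    (h : f =ᵐ[gaussian] g) : f = g :=
  Continuous.ae_eq_iff_eq (volume : Measure ℂ) hf hg |>.1 (volume_ac.ae_le h)

theorem integral_gaussian {E : Type*} [NormedAddCommGroup E] [NormedSpace ℝ E] (f : ℂ → E) :
    ∫ z, f z ∂gaussian = ∫ z, (Real.pi⁻¹ * Real.exp (-‖z‖ ^ 2)) • f z := by
  unfold gaussian
  rw [integral_withDensity_eq_integral_toReal_smul measurable_dens
    (Filter.Eventually.of_forall fun z => ENNReal.ofReal_lt_top)]
  simp_rw [ENNReal.toReal_ofReal (dens_pos _).le]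

theorem integrable_gaussian {E : Type*} [NormedAddCommGroup E] [NormedSpace ℝ E] (f : ℂ → E) :
    Integrable f gaussian ↔ Integrable fun z => (Real.pi⁻¹ * Real.exp (-‖z‖ ^ 2)) • f z := by
  unfold gaussian
  rw [integrable_withDensity_iff_integrable_smul' measurable_dens
    (Filter.Eventually.of_forall fun z => ENNReal.ofReal_lt_top)]
  simp_rw [ENNReal.toReal_ofReal (dens_pos _).le]

/-- The class of `f` in `L²` of the Gaussian measure. -/
def toL2 (f : Fock) : Lp ℂ 2 gaussian := f.memLp.toLp f

theorem coeFn_toL2 (f : Fock) : toL2 f =ᵐ[gaussian] f := f.memLp.coeFn_toLp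

/-- The inner product `⟨f, g⟩ = π⁻¹ ∫ conj (f z) g z e^{-|z|²} dV(z)`, conjugate-linear in the
first variable. -/
instance : Inner ℂ Fock := ⟨fun f g => ∫ z, conj (f z) * g z ∂gaussian⟩

theorem inner_def (f g : Fock) : inner ℂ f g = ∫ z, conj (f z) * g z ∂gaussian := rfl

theorem inner_toL2 (f g : Fock) : inner ℂ (toL2 f) (toL2 g) = inner ℂ f g := by
  rw [L2.inner_def, inner_def]
  refine integral_congr_ae ?_
  filter_upwards [coeFn_toL2 f, coeFn_toL2 g] with z h1 h2
  rw [h1, h2, RCLike.inner_apply, mul_comm]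

theorem toL2_add (f g : Fock) : toL2 (f + g) = toL2 f + toL2 g := rfl

theorem toL2_smul (c : ℂ) (f : Fock) : toL2 (c • f) = c • toL2 f := rfl

theorem toL2_injective : Function.Injective toL2 := fun f g h => by
  refine DFunLike.coe_injective (eq_of_ae f.differentiable.continuous g.differentiable.continuous ?_)
  exact (coeFn_toL2 f).symm.trans (h ▸ coeFn_toL2 g)

/-- The Fock inner product satisfies the axioms. -/
@[reducible] def core : InnerProductSpace.Core ℂ Fock where
  conj_inner_symm f g := by
    rw [← inner_toL2, ← inner_toL2]; exact inner_conj_symm _ _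
  re_inner_nonneg f := by
    rw [← inner_toL2]; exact inner_self_nonneg
  add_left f g h := by
    rw [← inner_toL2, ← inner_toL2, ← inner_toL2, toL2_add]; exact inner_add_left _ _ _
  smul_left f g r := by
    rw [← inner_toL2, ← inner_toL2, toL2_smul]; exact inner_smul_left _ _ _
  definite f h := by
    rw [← inner_toL2] at h
    exact toL2_injective (inner_self_eq_zero.1 h)

instance : NormedAddCommGroup Fock := @InnerProductSpace.Core.toNormedAddCommGroup ℂ _ _ _ _ core

instance : InnerProductSpace ℂ Fock := InnerProductSpace.ofCore core.toCore

/-- The isometric embedding into `L²`. -/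
def toL2ₗᵢ : Fock →ₗᵢ[ℂ] Lp ℂ 2 gaussian where
  toFun := toL2
  map_add' := toL2_add
  map_smul' := toL2_smul
  norm_map' f := by
    simp only [LinearMap.coe_mk, AddHom.coe_mk]
    rw [@norm_eq_sqrt_re_inner ℂ, @norm_eq_sqrt_re_inner ℂ _ _ _ _ f, inner_toL2]

theorem norm_sq_eq (f : Fock) : ‖f‖ ^ 2 = ∫ z, ‖f z‖ ^ 2 ∂gaussian := by
  have h : (inner ℂ f f : ℂ) = ((‖f‖ ^ 2 : ℝ) : ℂ) := by
    rw [inner_self_eq_norm_sq_to_K]; norm_num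
  have h2 : (inner ℂ f f : ℂ) = ((∫ z, ‖f z‖ ^ 2 ∂gaussian : ℝ) : ℂ) := by
    rw [inner_def, ← integral_complex_ofReal]
    refine integral_congr_ae (Filter.Eventually.of_forall fun z => ?_)
    change conj (f z) * f z = _
    rw [mul_comm, mul_conj, normSq_eq_norm_sq]
  exact_mod_cast h.symm.trans h2

theorem integral_dens : ∫ z : ℂ, Real.pi⁻¹ * Real.exp (-‖z‖ ^ 2) = 1 := by
  have h := GaussianFourier.integral_rexp_neg_mul_sq_norm (V := ℂ) (b := 1) one_pos
  rw [integral_const_mul]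
  simp only [neg_mul, one_mul, div_one, finrank_real_complex] at h
  rw [h]
  norm_num [Real.pi_ne_zero]

theorem integrable_dens : Integrable fun z : ℂ => Real.pi⁻¹ * Real.exp (-‖z‖ ^ 2) := by
  by_contra h
  have := integral_undef h
  rw [integral_dens] at this
  exact one_ne_zero this

instance : IsProbabilityMeasure gaussian := by
  refine ⟨?_⟩
  unfold gaussian
  rw [withDensity_apply _ MeasurableSet.univ, Measure.restrict_univ,
    ← ofReal_integral_eq_lintegral_ofReal integrable_dens
      (Filter.Eventually.of_forall fun z => (dens_pos z).le), integral_dens, ENNReal.ofReal_one]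

theorem measurePreserving_rot (u : ℂ) (hu : ‖u‖ = 1) :
    MeasurePreserving (fun w : ℂ => u * w) volume volume ∧
      MeasurableEmbedding fun w : ℂ => u * w := by
  let U : Circle := ⟨u, by simpa [Submonoid.unitSphere] using hu⟩
  exact ⟨(rotation U).measurePreserving, (rotation U).toHomeomorph.measurableEmbedding⟩

theorem integral_rot {E : Type*} [NormedAddCommGroup E] [NormedSpace ℝ E] (h : ℂ → E) (u : ℂ)
    (hu : ‖u‖ = 1) : ∫ w, h (u * w) ∂gaussian = ∫ w, h w ∂gaussian := by
  obtain ⟨h1, h2⟩ := measurePreserving_rot u hu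
  rw [integral_gaussian, integral_gaussian,
    ← h1.integral_comp h2 fun w => (Real.pi⁻¹ * Real.exp (-‖w‖ ^ 2)) • h w]
  simp_rw [norm_mul, hu, one_mul]

theorem integrable_rot (h : ℂ → ℂ) (u : ℂ) (hu : ‖u‖ = 1) (hi : Integrable h gaussian) :
    Integrable (fun w => h (u * w)) gaussian := by
  obtain ⟨h1, h2⟩ := measurePreserving_rot u hu
  rw [integrable_gaussian, ← h1.integrable_comp_emb h2] at hi
  rw [integrable_gaussian]
  simpa only [Function.comp_def, norm_mul, hu, one_mul] using hi

/-- Mean value property for the Gaussian measure. -/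
theorem integral_gaussian_eq (h : ℂ → ℂ) (hd : Differentiable ℂ h) (hi : Integrable h gaussian) :
    ∫ w, h w ∂gaussian = h 0 := by
  have hu : ∀ θ : ℝ, ‖circleMap 0 1 θ‖ = 1 := fun θ => by simp
  have hG : Integrable (Function.uncurry fun (θ : ℝ) (w : ℂ) => h (circleMap 0 1 θ * w))
      ((volume.restrict (Set.Ioc 0 (2 * Real.pi))).prod gaussian) := by
    have hm : Continuous (Function.uncurry fun (θ : ℝ) (w : ℂ) => h (circleMap 0 1 θ * w)) :=
      hd.continuous.comp
        (((continuous_circleMap 0 1).comp continuous_fst).mul continuous_snd)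
    rw [integrable_prod_iff hm.aestronglyMeasurable]
    simp only [Function.uncurry_apply_pair]
    refine ⟨Filter.Eventually.of_forall fun θ =>
      integrable_rot h (circleMap 0 1 θ) (hu θ) hi, ?_⟩
    have : ∀ θ : ℝ, ∫ w, ‖h (circleMap 0 1 θ * w)‖ ∂gaussian = ∫ w, ‖h w‖ ∂gaussian :=
      fun θ => integral_rot (fun w => ‖h w‖) _ (hu θ)
    simp_rw [this]
    exact integrable_const _
  have h1 : ∀ w, ∫ θ in Set.Ioc 0 (2 * Real.pi), h (circleMap 0 1 θ * w) =
      (2 * Real.pi) • h 0 := by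
    intro w
    have hdw : Differentiable ℂ fun u => h (u * w) := by fun_prop
    have := (hdw.diffContOnCl (s := Metric.ball 0 |(1 : ℝ)|)).circleAverage
    rw [Real.circleAverage_def, zero_mul,
      intervalIntegral.integral_of_le (by positivity)] at this
    rw [← this, smul_inv_smul₀ (by positivity)]
  have h2 := integral_integral_swap hG
  simp_rw [h1, integral_rot h _ (hu _)] at h2
  simp only [integral_const, Measure.real, Measure.restrict_apply_univ, Real.volume_Ioc,
    measure_univ, ENNReal.toReal_one, one_smul, sub_zero,
    ENNReal.toReal_ofReal Real.two_pi_pos.le] at h2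
  exact smul_right_injective ℂ Real.two_pi_pos.ne' h2

theorem translate_aux (f : ℂ → ℂ) (z w : ℂ) :
    (Real.pi⁻¹ * Real.exp (-‖w‖ ^ 2)) • ‖f (z + w) * exp (-(w * conj z))‖ ^ 2 =
      Real.exp (‖z‖ ^ 2) *
        ((Real.pi⁻¹ * Real.exp (-‖z + w‖ ^ 2)) • ‖f (z + w)‖ ^ 2) := by
  have h : ‖z + w‖ ^ 2 = ‖z‖ ^ 2 + ‖w‖ ^ 2 + 2 * (w * conj z).re := by
    rw [← normSq_eq_norm_sq, ← normSq_eq_norm_sq, ← normSq_eq_norm_sq, normSq_add]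
    simp
    ring
  rw [norm_mul, mul_pow, norm_exp, h, smul_eq_mul, smul_eq_mul, ← Real.exp_nat_mul]
  have : Real.exp (-(‖z‖ ^ 2 + ‖w‖ ^ 2 + 2 * (w * conj z).re)) =
      Real.exp (-‖z‖ ^ 2) * Real.exp (-‖w‖ ^ 2) * Real.exp ((2 : ℕ) * (-(w * conj z)).re) := by
    rw [← Real.exp_add, ← Real.exp_add]; congr 1; simp; ring
  rw [this, Real.exp_neg (‖z‖ ^ 2)]
  field_simp

theorem translate_memLp (f : Fock) (z : ℂ) :
    MemLp (fun w => f (z + w) * exp (-(w * conj z))) 2 gaussian ∧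
    ∫ w, ‖f (z + w) * exp (-(w * conj z))‖ ^ 2 ∂gaussian = Real.exp (‖z‖ ^ 2) * ‖f‖ ^ 2 := by
  have hd := f.differentiable.continuous
  have hf := f.memLp
  rw [memLp_two_iff_integrable_sq_norm (by fun_prop), integrable_gaussian] at hf ⊢
  rw [integral_gaussian, norm_sq_eq, integral_gaussian]
  simp_rw [translate_aux]
  exact ⟨(hf.comp_add_left z).const_mul _, by
    rw [integral_const_mul, integral_add_left_eq_self
      (fun w => (Real.pi⁻¹ * Real.exp (-‖w‖ ^ 2)) • ‖f w‖ ^ 2) z]⟩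

/-- Point evaluations are bounded on the Fock space. -/
theorem norm_apply_le (f : Fock) (z : ℂ) : ‖f z‖ ≤ Real.exp (‖z‖ ^ 2 / 2) * ‖f‖ := by
  obtain ⟨h1, h2⟩ := translate_memLp f z
  have hd := f.differentiable
  have h3 := integral_gaussian_eq _ (by fun_prop) (h1.integrable one_le_two)
  simp only [add_zero, zero_mul, neg_zero, Complex.exp_zero, mul_one] at h3
  set h := fun w => f (z + w) * exp (-(w * conj z)) with hh
  have h4 : ‖f z‖ ≤ ∫ w, ‖h w‖ ∂gaussian := h3 ▸ norm_integral_le_integral_norm _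
  have h5 : (∫ w, ‖h w‖ ∂gaussian) ^ 2 ≤ ∫ w, ‖h w‖ ^ 2 ∂gaussian := by
    set m := ∫ w, ‖h w‖ ∂gaussian with hm
    have hn : Integrable (fun w => ‖h w‖) gaussian := (h1.integrable one_le_two).norm
    have hs : Integrable (fun w => ‖h w‖ ^ 2) gaussian :=
      (memLp_two_iff_integrable_sq_norm h1.1).1 h1
    have : 0 ≤ ∫ w, (‖h w‖ ^ 2 - 2 * m * ‖h w‖ + m ^ 2) ∂gaussian :=
      integral_nonneg fun w => by
        change 0 ≤ ‖h w‖ ^ 2 - 2 * m * ‖h w‖ + m ^ 2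
        nlinarith [sq_nonneg (‖h w‖ - m)]
    rw [integral_add (f := fun w => ‖h w‖ ^ 2 - 2 * m * ‖h w‖) (hs.sub (hn.const_mul _))
      (integrable_const _), integral_sub hs (hn.const_mul _), integral_const_mul, ← hm] at this
    simp at this
    nlinarith
  rw [h2] at h5
  refine h4.trans (abs_le_of_sq_le_sq' ?_ (by positivity)).2
  rw [mul_pow, ← Real.exp_nat_mul]
  have : ((2 : ℕ) : ℝ) * (‖z‖ ^ 2 / 2) = ‖z‖ ^ 2 := by push_cast; ring
  rwa [this]

instance : CompleteSpace Fock := by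
  have hcl : IsClosed (Set.range toL2ₗᵢ) := by
    refine isSeqClosed_iff_isClosed.1 fun u g hu hg => ?_
    choose f hf using hu
    have hfc : CauchySeq f := by
      have := hg.cauchySeq
      rw [Metric.cauchySeq_iff] at this ⊢
      simpa only [← hf, toL2ₗᵢ.isometry.dist_eq] using this
    have hpc : ∀ z, CauchySeq fun n => f n z := fun z => by
      rw [Metric.cauchySeq_iff'] at hfc ⊢
      intro ε hε
      obtain ⟨N, hN⟩ := hfc (ε / Real.exp (‖z‖ ^ 2 / 2)) (by positivity)
      refine ⟨N, fun n hn => ?_⟩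
      have := hN n hn
      rw [dist_eq_norm, lt_div_iff₀' (by positivity)] at this
      rw [dist_eq_norm, ← sub_apply]
      exact (norm_apply_le _ _).trans_lt this
    choose F hF using fun z => cauchySeq_tendsto_of_complete (hpc z)
    have hlu : TendstoLocallyUniformlyOn (fun n z => f n z) F Filter.atTop Set.univ := by
      rw [tendstoLocallyUniformlyOn_iff_forall_isCompact isOpen_univ]
      intro K _ hK
      obtain ⟨r, hr⟩ := hK.isBounded.exists_norm_le
      refine UniformCauchySeqOn.tendstoUniformlyOn_of_tendsto ?_ fun z _ => hF z
      rw [Metric.uniformCauchySeqOn_iff]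
      intro ε hε
      rw [Metric.cauchySeq_iff] at hfc
      obtain ⟨N, hN⟩ := hfc (ε / Real.exp (r ^ 2 / 2)) (by positivity)
      refine ⟨N, fun m hm n hn z hz => ?_⟩
      have := hN m hm n hn
      rw [dist_eq_norm, lt_div_iff₀' (by positivity)] at this
      rw [dist_eq_norm, ← sub_apply]
      refine (norm_apply_le _ _).trans_lt (lt_of_le_of_lt ?_ this)
      have := hr z hz
      gcongr
    have hd : Differentiable ℂ F := by
      rw [← differentiableOn_univ]
      exact hlu.differentiableOn
        (Filter.Eventually.of_forall fun n => (f n).differentiable.differentiableOn) isOpen_univ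
    obtain ⟨ns, _, hns⟩ := (tendstoInMeasure_of_tendsto_Lp hg).exists_seq_tendsto_ae
    have hae : g =ᵐ[gaussian] F := by
      have h1 : ∀ᵐ z ∂gaussian, ∀ n, u n z = f n z := ae_all_iff.2 fun n => by
        rw [← hf n]; exact coeFn_toL2 (f n)
      filter_upwards [hns, h1] with z hz h1
      simp_rw [h1] at hz
      exact tendsto_nhds_unique hz ((hF z).comp ‹StrictMono ns›.tendsto_atTop)
    refine ⟨mk F ⟨hd, (memLp_congr_ae hae).1 (Lp.memLp g)⟩, ?_⟩
    exact Lp.ext ((coeFn_toL2 _).trans hae.symm)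
  exact (completeSpace_iff_isComplete_range toL2ₗᵢ.isometry.isUniformInducing).2 hcl.isComplete

end Fock

/-! ## Conjugations and complex symmetry -/

section Hilbert

variable {H : Type*} [NormedAddCommGroup H] [InnerProductSpace ℂ H]

/-- A conjugation: an anti-linear, isometric involution. -/
structure Conjugation (H : Type*) [NormedAddCommGroup H] [InnerProductSpace ℂ H] where
  /-- the underlying map -/
  toFun : H → H
  map_add : ∀ x y, toFun (x + y) = toFun x + toFun y
  map_smul : ∀ (c : ℂ) x, toFun (c • x) = conj c • toFun x
  norm_map : ∀ x, ‖toFun x‖ = ‖x‖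
  involutive : Function.Involutive toFun

instance : CoeFun (Conjugation H) fun _ => H → H := ⟨Conjugation.toFun⟩

/-- The operator `C T C`, with domain `{x | C x ∈ dom T}`. -/
def Conjugation.conjOp (C : Conjugation H) (T : H →ₗ.[ℂ] H) : H →ₗ.[ℂ] H where
  domain :=
    { carrier := {x | C x ∈ T.domain}
      add_mem' := fun {x y} hx hy => by
        change C (x + y) ∈ T.domain
        rw [C.map_add]; exact T.domain.add_mem hx hy
      zero_mem' := by
        change C 0 ∈ T.domain
        have h := C.map_smul 0 0
        rw [zero_smul, map_zero, zero_smul] at h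
        rw [h]; exact T.domain.zero_mem
      smul_mem' := fun c x hx => by
        change C (c • x) ∈ T.domain
        rw [C.map_smul]; exact T.domain.smul_mem _ hx }
  toFun :=
    { toFun := fun x => C (T ⟨C x, x.2⟩)
      map_add' := fun x y => by
        rw [← C.map_add, ← T.map_add]
        congr 2
        exact Subtype.ext (C.map_add x y)
      map_smul' := fun c x => by
        have h : T ⟨C ↑(c • x), (c • x).2⟩ = conj c • T ⟨C x, x.2⟩ := by
          rw [← T.map_smul]
          congr 1
          exact Subtype.ext (C.map_smul c x)
        rw [h, C.map_smul, conj_conj, RingHom.id_apply] }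

/-- `T` is `C`-symmetric: `⟨C x, T y⟩ = ⟨C T x, y⟩` for all `x, y ∈ dom T`. -/
def IsCSymmetric (C : Conjugation H) (T : H →ₗ.[ℂ] H) : Prop :=
  ∀ x y : T.domain, inner ℂ (C x) (T y) = inner ℂ (C (T x)) (y : H)

/-- `T` is `C`-selfadjoint: it is densely defined and `T = C T* C`. -/
def IsCSelfAdjoint [CompleteSpace H] (C : Conjugation H) (T : H →ₗ.[ℂ] H) : Prop :=
  Dense (T.domain : Set H) ∧ T = C.conjOp T.adjoint

/-- The point spectrum of an unbounded operator. -/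
def pointSpectrum (A : H →ₗ.[ℂ] H) : Set ℂ :=
  {η | ∃ x : A.domain, (x : H) ≠ 0 ∧ A x = η • (x : H)}

/-! ## Semigroups of unbounded operators

A family `(T(t))_{t ≥ 0}` is indexed by `ℝ`, and only its members with `0 ≤ t` matter. -/

open Classical in
/-- The value `A x` for `x ∈ dom A`, and zero otherwise. -/
def opApply (A : H →ₗ.[ℂ] H) (x : H) : H :=
  if h : x ∈ A.domain then A ⟨x, h⟩ else 0

/-- The intersection of the domains of all products `T(t) T(s)`, where `s, t ≥ 0`. -/
def productDomain (T : ℝ → H →ₗ.[ℂ] H) : Set H :=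
  {x | ∀ t s : ℝ, 0 ≤ t → 0 ≤ s → x ∈ (T s).domain ∧ opApply (T s) x ∈ (T t).domain}

/-- The vectors on which the family satisfies the semigroup law and is strongly continuous
(the zero vector included). -/
def regularVectors (T : ℝ → H →ₗ.[ℂ] H) : Set H :=
  {x | x ∈ productDomain T ∧
    (∀ t s : ℝ, 0 ≤ t → 0 ≤ s → opApply (T t) (opApply (T s) x) = opApply (T (t + s)) x) ∧
    ContinuousOn (fun t => opApply (T t) x) (Set.Ioi 0) ∧
    Filter.Tendsto (fun t => ‖opApply (T t) x - x‖) (𝓝[>] 0) (𝓝 0)}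

/-- An unbounded `C₀`-semigroup: some nonzero vector is regular. -/
def IsUnboundedC0Semigroup (T : ℝ → H →ₗ.[ℂ] H) : Prop :=
  ∃ x ∈ regularVectors T, x ≠ 0

/-- The space `Σ_ω` of the regular vectors `x` with `sup_{t ≥ 0} e^{-ωt} ‖T(t)x‖ < ∞`. -/
def sigmaSpace (T : ℝ → H →ₗ.[ℂ] H) (ω : ℝ) : Set H :=
  {x | x ∈ regularVectors T ∧
    BddAbove ((fun t : ℝ => Real.exp (-(ω * t)) * ‖opApply (T t) x‖) '' Set.Ici 0)}

/-- The Laplace transform `∫₀^∞ e^{-μt} T(t)x dt`. -/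
def laplace (T : ℝ → H →ₗ.[ℂ] H) (μ : ℂ) (x : H) : H :=
  ∫ t in Set.Ioi (0 : ℝ), exp (-(μ * t)) • opApply (T t) x

/-- `A` is the generator of the family `T`: the domain of `A` consists of the vectors
`x = ∫₀^∞ e^{-μt} T(t)y dt` with `y ∈ Σ_ω` and `Re μ > ω` for some `ω ∈ ℝ`, and `A x = μ x - y`
for such `x`. -/
def IsGenerator (T : ℝ → H →ₗ.[ℂ] H) (A : H →ₗ.[ℂ] H) : Prop :=
  ∀ x z : H, (x, z) ∈ A.graph ↔
    ∃ (ω : ℝ) (μ : ℂ) (y : H), ω < μ.re ∧ y ∈ sigmaSpace T ω ∧ x = laplace T μ y ∧ z = μ • x - y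

/-- A family has at most one generator. -/
theorem IsGenerator.unique {T : ℝ → H →ₗ.[ℂ] H} {A B : H →ₗ.[ℂ] H} (hA : IsGenerator T A)
    (hB : IsGenerator T B) : A = B :=
  LinearPMap.eq_of_eq_graph (Submodule.ext fun p => (hA p.1 p.2).trans (hB p.1 p.2).symm)

end Hilbert

/-! ## Weighted composition operators and conjugations on the Fock space -/

/-- The maximal weighted composition operator `f ↦ ψ · f ∘ φ`, whose domain consists of all `f` in
the Fock space for which `ψ · f ∘ φ` lies in the Fock space. -/
def wcMax (ψ φ : ℂ → ℂ) : Fock →ₗ.[ℂ] Fock where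
  domain :=
    { carrier := {f | MemFock fun z => ψ z * f (φ z)}
      add_mem' := fun {f g} hf hg => by
        have h := fockSubmodule.add_mem hf hg
        have e : (fun z => ψ z * (f + g) (φ z)) =
            (fun z => ψ z * f (φ z)) + fun z => ψ z * g (φ z) := by
          ext z; simp [mul_add]
        change MemFock _
        rw [e]; exact h
      zero_mem' := by
        have e : (fun z => ψ z * (0 : Fock) (φ z)) = 0 := by
          ext z; simp
        change MemFock _
        rw [e]; exact fockSubmodule.zero_mem
      smul_mem' := fun c f hf => by
        have h := fockSubmodule.smul_mem c hf
        have e : (fun z => ψ z * (c • f) (φ z)) = c • fun z => ψ z * f (φ z) := by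
          ext z; simp; ring
        change MemFock _
        rw [e]; exact h }
  toFun :=
    { toFun := fun f => Fock.mk (fun z => ψ z * (f : Fock) (φ z)) f.2
      map_add' := fun f g => by ext z; simp [mul_add]
      map_smul' := fun c f => by ext z; simp; ring }

/-- The admissible parameters of a weighted composition conjugation. -/
structure ConjParam (a b c : ℂ) : Prop where
  norm_a : ‖a‖ = 1
  ab : conj a * b + conj b = 0
  norm_c : ‖c‖ ^ 2 * Real.exp (‖b‖ ^ 2) = 1

namespace ConjParam

variable {a b c : ℂ}

theorem conj_a_mul (h : ConjParam a b c) : conj a * a = 1 := by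
  rw [mul_comm, mul_conj, normSq_eq_norm_sq, h.norm_a]; norm_num

theorem b_eq (h : ConjParam a b c) : b = -(a * conj b) := by
  linear_combination a * h.ab - b * h.conj_a_mul

theorem weight (h : ConjParam a b c) (f : ℂ → ℂ) (z : ℂ) :
    (Real.pi⁻¹ * Real.exp (-‖z‖ ^ 2)) •
        ‖c * exp (b * z) * conj (f (conj (a * z + b)))‖ ^ 2 =
      (Real.pi⁻¹ * Real.exp (-‖conj (a * z + b)‖ ^ 2)) • ‖f (conj (a * z + b))‖ ^ 2 := by
  have h1 : ‖conj (a * z + b)‖ ^ 2 = ‖z‖ ^ 2 - 2 * (b * z).re + ‖b‖ ^ 2 := by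
    have e : (b * z).re = -(a * z * conj b).re := by
      conv_lhs => rw [h.b_eq]
      rw [← neg_re]; congr 1; ring
    rw [norm_conj, ← normSq_eq_norm_sq, normSq_add, normSq_eq_norm_sq, normSq_eq_norm_sq, norm_mul,
      h.norm_a, e]
    ring
  have h2 : Real.exp (-‖conj (a * z + b)‖ ^ 2) * Real.exp (‖b‖ ^ 2) =
      Real.exp (-‖z‖ ^ 2) * Real.exp ((b * z).re) ^ 2 := by
    rw [h1, ← Real.exp_nat_mul, ← Real.exp_add, ← Real.exp_add]; congr 1; push_cast; ring
  rw [norm_mul, norm_mul, norm_exp, norm_conj, smul_eq_mul, smul_eq_mul]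
  linear_combination Real.pi⁻¹ * ‖f (conj (a * z + b))‖ ^ 2 *
    (Real.exp (-‖conj (a * z + b)‖ ^ 2) * h.norm_c - ‖c‖ ^ 2 * h2)

theorem measurePreserving (h : ConjParam a b c) :
    MeasurePreserving (fun z : ℂ => conj (a * z + b)) volume volume ∧
      MeasurableEmbedding fun z : ℂ => conj (a * z + b) := by
  obtain ⟨h1, h2⟩ := Fock.measurePreserving_rot a h.norm_a
  refine ⟨(conjLIE.measurePreserving.comp (measurePreserving_add_right volume b)).comp h1, ?_⟩
  exact (conjLIE.toHomeomorph.measurableEmbedding.comp (measurableEmbedding_addRight b)).comp h2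

theorem memFock (h : ConjParam a b c) (f : Fock) :
    MemFock fun z => c * exp (b * z) * conj (f (conj (a * z + b))) := by
  have hd : Differentiable ℂ fun z => conj (f (conj z)) := fun z => by
    have := (f.differentiable (conj z)).conj_conj
    rwa [conj_conj] at this
  have hd2 : Differentiable ℂ fun z => c * exp (b * z) * conj (f (conj (a * z + b))) := by
    have : Differentiable ℂ fun z => conj (f (conj (a * z + b))) :=
      hd.comp (g := fun z => conj (f (conj z))) (f := fun z => a * z + b) (by fun_prop)
    fun_prop
  refine ⟨hd2, ?_⟩
  obtain ⟨h1, h2⟩ := h.measurePreserving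
  have hf := f.memLp
  rw [memLp_two_iff_integrable_sq_norm f.differentiable.continuous.aestronglyMeasurable,
    Fock.integrable_gaussian, ← h1.integrable_comp_emb h2] at hf
  rw [memLp_two_iff_integrable_sq_norm hd2.continuous.aestronglyMeasurable,
    Fock.integrable_gaussian]
  simp_rw [h.weight f]
  exact hf

end ConjParam

/-- The weighted composition conjugation `f ↦ c e^{bz} conj (f (conj (a z + b)))`. -/
def wcConj (a b c : ℂ) (h : ConjParam a b c) : Conjugation Fock where
  toFun f := Fock.mk (fun z => c * exp (b * z) * conj (f (conj (a * z + b)))) (h.memFock f)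
  map_add f g := by ext z; simp [mul_add]
  map_smul r f := by ext z; simp; ring
  norm_map f := by
    obtain ⟨h1, h2⟩ := h.measurePreserving
    rw [← sq_eq_sq₀ (norm_nonneg _) (norm_nonneg _), Fock.norm_sq_eq, Fock.norm_sq_eq,
      Fock.integral_gaussian, Fock.integral_gaussian,
      ← h1.integral_comp h2 fun z => (Real.pi⁻¹ * Real.exp (-‖z‖ ^ 2)) • ‖f z‖ ^ 2]
    simp_rw [Fock.mk_apply, h.weight f]
  involutive f := by
    ext z
    have e1 : conj (a * conj (a * z + b) + b) = z := by
      simp only [map_add, map_mul, conj_conj]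
      linear_combination z * h.conj_a_mul + h.ab
    have e2 : c * conj c * exp (conj b * b) = 1 := by
      rw [mul_conj, normSq_eq_norm_sq, mul_comm (conj b), mul_conj, normSq_eq_norm_sq,
        ← ofReal_exp, ← ofReal_mul, h.norm_c, ofReal_one]
    have e3 : exp (b * z) * exp (conj b * (a * z + b)) = exp (conj b * b) := by
      rw [← Complex.exp_add]; congr 1
      linear_combination z * h.b_eq
    simp only [Fock.mk_apply, e1, map_mul, ← exp_conj, conj_conj]
    linear_combination f z * c * conj c * e3 + f z * e2

/-- The semiflow `ζ_t(z) = e^{ℓt} z + G (1 - e^{ℓt})`. -/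
def semiflow (ℓ G : ℂ) (t : ℝ) (z : ℂ) : ℂ :=
  exp (ℓ * t) * z + G * (1 - exp (ℓ * t))

/-- The semicocycle `ξ_t(z) = C(t) e^{z D(t)}` with `D(t) = (aG + b)(1 - e^{ℓt})` and
`C(t) = exp (Ht + G (aG + b)(e^{ℓt} - ℓt - 1))`. -/
def semicocycle (a b ℓ G H : ℂ) (t : ℝ) (z : ℂ) : ℂ :=
  exp (H * t + G * (a * G + b) * (exp (ℓ * t) - ℓ * t - 1)) *
    exp (z * ((a * G + b) * (1 - exp (ℓ * t))))

end CSym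

end

/-! Write `E = aG + b` and let `L f` be the first order expression `genExpr`. For each fixed `z` and
entire `f`, the function `t ↦ ξ_t(z) f(ζ_t(z))` has derivative `ξ_t(z) (L f)(ζ_t(z))`. Point
evaluations are bounded on the Fock space, so they turn vector-valued Laplace integrals into scalar
ones, and the generator is found by calculus. If `f` and `L f` lie in `Σ_ω`, the Laplace integrand
of `μ f - L f` is an exact derivative and the integral is `f` (`laplace_of_genExpr`). Conversely, if
`x` is the transform of `y`, differentiating `T(s)x` at `s = 0` in two ways gives `L x = μ x - y`
(`genExpr_laplace`).

`C`-selfadjointness enters as closedness: each `T(r)` passes under the integral sign, so Laplace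
transforms stay in `Σ_ω` (`laplace_mem_sigmaSpace`). It also makes the transforms symmetric for the
form `⟨C x, y⟩`, hence `R` too, and it gives `T(t)* = C T(t) C`. The adjoint family is therefore
generated by `C R C`, and `R*` could be its generator only if `R` were `C`-selfadjoint.

For `ℓ > 0` and `E ≠ 0` this fails. Exponentials `e^{Uz}` are reproducing kernels, and they lie in
`dom R*` because values and derivatives at a point are bounded functionals; `C` maps kernels to
multiples of kernels. Selfadjointness would put the constant `1` in `dom R`, but its orbit grows
doubly exponentially at the point `G - conj E`. Density of `dom R` comes from the functions `(z -
G)^k e^{Ez}`, joint eigenvectors of all `T(t)` whose pairings with `g` encode all Taylor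
coefficients of `g` at one point. The point spectrum is read off from the order of vanishing of an
eigenfunction at `G`. -/

namespace CSym

/-! ### Conjugations and `C`-selfadjoint operators on a Hilbert space. -/

section Abstract

variable {H : Type*} [NormedAddCommGroup H] [InnerProductSpace ℂ H]

namespace Conjugation

variable (C : Conjugation H)

@[simp] theorem apply_apply (x : H) : C (C x) = x := C.involutive x

theorem map_zero : C 0 = 0 := by
  simpa using C.map_smul 0 0

theorem map_neg (x : H) : C (-x) = -C x := by
  simpa using C.map_smul (-1) x

theorem map_sub (x y : H) : C (x - y) = C x - C y := by
  rw [sub_eq_add_neg, C.map_add, C.map_neg, ← sub_eq_add_neg]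

/-- Polarization: antilinearity changes the sign of `I • y`, so the two imaginary terms trade places
and the arguments come back swapped. -/
theorem inner_map_map (x y : H) : inner ℂ (C x) (C y) = inner ℂ y x := by
  have hI : C (Complex.I • y) = -(Complex.I • C y) := by
    rw [C.map_smul]; simp
  have hI' : C (Complex.I • x) = -(Complex.I • C x) := by
    rw [C.map_smul]; simp
  rw [inner_eq_sum_norm_sq_div_four, inner_eq_sum_norm_sq_div_four]
  have h1 : ‖C x + C y‖ = ‖y + x‖ := by rw [← C.map_add, C.norm_map, add_comm]
  have h2 : ‖C x - C y‖ = ‖y - x‖ := by rw [← C.map_sub, C.norm_map, norm_sub_rev]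
  have h3 : ‖C x - Complex.I • C y‖ = ‖x + Complex.I • y‖ := by
    rw [← C.norm_map (x + _), C.map_add, hI, sub_eq_add_neg]
  have h4 : ‖C x + Complex.I • C y‖ = ‖x - Complex.I • y‖ := by
    rw [← C.norm_map (x - _), C.map_sub, hI, sub_neg_eq_add]
  have h5 : ‖x + Complex.I • y‖ = ‖y - Complex.I • x‖ := by
    have : y - Complex.I • x = -(Complex.I • (x + Complex.I • y)) := by
      rw [smul_add, smul_smul, I_mul_I]; simp; abel
    rw [this, norm_neg, norm_smul, norm_I, one_mul]
  have h6 : ‖x - Complex.I • y‖ = ‖y + Complex.I • x‖ := by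
    have : y + Complex.I • x = Complex.I • (x - Complex.I • y) := by
      rw [smul_sub, smul_smul, I_mul_I]; simp; abel
    rw [this, norm_smul, norm_I, one_mul]
  simp only [RCLike.I_to_complex]
  rw [h1, h2, h3, h4, h5, h6]

theorem inner_map_left (x y : H) : inner ℂ (C x) y = inner ℂ (C y) x := by
  conv_lhs => rw [← C.apply_apply y, C.inner_map_map]

/-- A conjugation as a real-linear isometric equivalence. -/
def toLinearIsometryEquiv : H ≃ₗᵢ[ℝ] H where
  toFun := C
  invFun := C
  left_inv := C.involutive
  right_inv := C.involutive
  map_add' := C.map_add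
  map_smul' r x := by
    change C (r • x) = r • C x
    rw [← Complex.coe_smul, C.map_smul, conj_ofReal, Complex.coe_smul]
  norm_map' := C.norm_map

theorem continuous : Continuous C := C.toLinearIsometryEquiv.continuous

/-- A real-linear homeomorphism commutes with the Bochner integral, so no integrability is required.
-/
theorem integral_comp {α : Type*} [MeasurableSpace α] (ν : Measure α) (f : α → H) :
    ∫ t, C (f t) ∂ν = C (∫ t, f t ∂ν) :=
  C.toLinearIsometryEquiv.toContinuousLinearEquiv.integral_comp_comm f

theorem mem_conjOp {A : H →ₗ.[ℂ] H} {x : H} : x ∈ (C.conjOp A).domain ↔ C x ∈ A.domain := Iff.rfl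

theorem conjOp_conjOp (A : H →ₗ.[ℂ] H) : C.conjOp (C.conjOp A) = A := by
  refine LinearPMap.ext (by ext x; simp [mem_conjOp]) fun x hx hx' => ?_
  change C (C (A ⟨C (C x), _⟩)) = _
  simp

theorem mem_graph_conjOp {A : H →ₗ.[ℂ] H} {x y : H} :
    (x, y) ∈ (C.conjOp A).graph ↔ (C x, C y) ∈ A.graph := by
  simp only [LinearPMap.mem_graph_iff]
  constructor
  · rintro ⟨u, rfl, rfl⟩
    exact ⟨⟨C u, u.2⟩, rfl, (C.apply_apply _).symm⟩
  · rintro ⟨⟨u, hu⟩, h1, h2⟩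
    change u = C x at h1
    subst h1
    exact ⟨⟨x, hu⟩, rfl, by change C (A _) = _; rw [h2, C.apply_apply]⟩

end Conjugation

theorem opApply_of_mem {A : H →ₗ.[ℂ] H} {x : H} (h : x ∈ A.domain) : opApply A x = A ⟨x, h⟩ :=
  dif_pos h

theorem opApply_add {A : H →ₗ.[ℂ] H} {x y : H} (hx : x ∈ A.domain) (hy : y ∈ A.domain) :
    opApply A (x + y) = opApply A x + opApply A y := by
  rw [opApply_of_mem hx, opApply_of_mem hy, opApply_of_mem (A.domain.add_mem hx hy), ← A.map_add]
  rfl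

theorem opApply_smul {A : H →ₗ.[ℂ] H} {x : H} (c : ℂ) (hx : x ∈ A.domain) :
    opApply A (c • x) = c • opApply A x := by
  rw [opApply_of_mem hx, opApply_of_mem (A.domain.smul_mem c hx), ← A.map_smul]
  rfl

theorem opApply_conjOp (C : Conjugation H) (A : H →ₗ.[ℂ] H) (x : H) :
    opApply (C.conjOp A) x = C (opApply A (C x)) := by
  by_cases h : C x ∈ A.domain
  · rw [opApply_of_mem h, opApply_of_mem (A := C.conjOp A) h]; rfl
  -- Off the domain both sides take the default value `0`.
  · rw [opApply, opApply, dif_neg h, dif_neg (mt C.mem_conjOp.1 h), C.map_zero]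

namespace IsCSelfAdjoint

variable [CompleteSpace H] {C : Conjugation H} {A : H →ₗ.[ℂ] H}

theorem adjoint_eq (h : IsCSelfAdjoint C A) : A.adjoint = C.conjOp A := by
  conv_rhs => rw [h.2]
  rw [C.conjOp_conjOp]

theorem isCSymmetric (h : IsCSelfAdjoint C A) : IsCSymmetric C A := fun x y => by
  have hx : C x ∈ A.adjoint.domain := by
    rw [h.adjoint_eq, C.mem_conjOp, C.apply_apply]; exact x.2
  have e : A.adjoint ⟨C x, hx⟩ = C (A x) := by
    rw [← opApply_of_mem, h.adjoint_eq, opApply_conjOp, C.apply_apply, opApply_of_mem x.2]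
  rw [← e]
  exact (LinearPMap.adjoint_isFormalAdjoint h.1 ⟨C x, hx⟩ y).symm

/-- The hypothesis says that `A*` sends `C x` to `C y`; conjugating back with `A = C A* C` returns
to `A`. This turns domain membership into a weak identity tested on `dom A`. -/
theorem mem_domain_of_inner (h : IsCSelfAdjoint C A) {x y : H}
    (hxy : ∀ u : A.domain, inner ℂ (C x) (A u) = inner ℂ (C y) (u : H)) :
    x ∈ A.domain ∧ opApply A x = y := by
  have hx : C x ∈ A.adjoint.domain :=
    LinearPMap.mem_adjoint_domain_of_exists _ ⟨C y, fun u => (hxy u).symm⟩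
  have hx' : x ∈ (C.conjOp A.adjoint).domain := hx
  refine ⟨h.2 ▸ hx', ?_⟩
  conv_lhs => rw [h.2]
  rw [opApply_conjOp, opApply_of_mem hx,
    LinearPMap.adjoint_apply_eq h.1 ⟨C x, hx⟩ fun u => (hxy u).symm, C.apply_apply]

/-- A `C`-selfadjoint operator commutes with integrals. -/
theorem opApply_integral (h : IsCSelfAdjoint C A) {α : Type*} [MeasurableSpace α] {ν : Measure α}
    {f g : α → H} (hf : Integrable f ν) (hg : Integrable g ν)
    (hd : ∀ᵐ t ∂ν, f t ∈ A.domain ∧ opApply A (f t) = g t) :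
    ∫ t, f t ∂ν ∈ A.domain ∧ opApply A (∫ t, f t ∂ν) = ∫ t, g t ∂ν := by
  refine h.mem_domain_of_inner fun u => ?_
  -- The symmetry of `⟨C x, y⟩` moves the integrals into the linear slot, where they can be pulled
  -- out.
  rw [C.inner_map_left, C.inner_map_left (∫ t, g t ∂ν), ← integral_inner hf, ← integral_inner hg]
  refine integral_congr_ae ?_
  filter_upwards [hd] with t ht
  rw [← ht.2, opApply_of_mem ht.1, h.isCSymmetric u ⟨f t, ht.1⟩]

end IsCSelfAdjoint

/-! ### Regular vectors, the spaces `Σ_ω` and Laplace transforms. -/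

section Sigma

variable {T S : ℝ → H →ₗ.[ℂ] H}

theorem regularVectors.mem_domain {x : H} (hx : x ∈ regularVectors T) {t : ℝ} (ht : 0 ≤ t) :
    x ∈ (T t).domain := (hx.1 t t ht ht).1

theorem opApply_zero (A : H →ₗ.[ℂ] H) : opApply A 0 = 0 := by
  rw [opApply_of_mem A.domain.zero_mem]
  exact A.map_zero

theorem zero_mem_regularVectors : (0 : H) ∈ regularVectors T := by
  refine ⟨fun t s _ _ => ⟨(T s).domain.zero_mem, ?_⟩, fun t s _ _ => ?_, ?_, ?_⟩
  · rw [opApply_zero]; exact (T t).domain.zero_mem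
  · simp_rw [opApply_zero]
  · simp_rw [opApply_zero]; exact continuousOn_const
  · simp [opApply_zero]

theorem regularVectors.add {x y : H} (hx : x ∈ regularVectors T) (hy : y ∈ regularVectors T) :
    x + y ∈ regularVectors T := by
  have hx0 := fun {t : ℝ} (ht : 0 ≤ t) => regularVectors.mem_domain hx ht
  have hy0 := fun {t : ℝ} (ht : 0 ≤ t) => regularVectors.mem_domain hy ht
  have e : ∀ t : ℝ, 0 ≤ t → opApply (T t) (x + y) = opApply (T t) x + opApply (T t) y :=
    fun t ht => opApply_add (hx0 ht) (hy0 ht)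
  obtain ⟨hx1, hx2, hx3, hx4⟩ := hx
  obtain ⟨hy1, hy2, hy3, hy4⟩ := hy
  refine ⟨fun t s ht hs => ⟨(T s).domain.add_mem (hx0 hs) (hy0 hs), ?_⟩, fun t s ht hs => ?_,
    (hx3.add hy3).congr fun t ht => e t (le_of_lt ht), ?_⟩
  · rw [e s hs]
    exact (T t).domain.add_mem (hx1 t s ht hs).2 (hy1 t s ht hs).2
  · rw [e s hs, opApply_add (hx1 t s ht hs).2 (hy1 t s ht hs).2, hx2 t s ht hs, hy2 t s ht hs,
      e _ (add_nonneg ht hs)]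
  · rw [← tendsto_zero_iff_norm_tendsto_zero] at hx4 hy4 ⊢
    have := hx4.add hy4
    rw [add_zero] at this
    refine this.congr' ?_
    filter_upwards [self_mem_nhdsWithin] with t ht
    rw [e t (le_of_lt ht)]; abel

theorem regularVectors.smul {x : H} (c : ℂ) (hx : x ∈ regularVectors T) :
    c • x ∈ regularVectors T := by
  have hx0 := fun {t : ℝ} (ht : 0 ≤ t) => regularVectors.mem_domain hx ht
  have e : ∀ t : ℝ, 0 ≤ t → opApply (T t) (c • x) = c • opApply (T t) x :=
    fun t ht => opApply_smul c (hx0 ht)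
  obtain ⟨hx1, hx2, hx3, hx4⟩ := hx
  refine ⟨fun t s ht hs => ⟨(T s).domain.smul_mem c (hx0 hs), ?_⟩, fun t s ht hs => ?_,
    (hx3.const_smul c).congr fun t ht => e t (le_of_lt ht), ?_⟩
  · rw [e s hs]
    exact (T t).domain.smul_mem c (hx1 t s ht hs).2
  · rw [e s hs, opApply_smul c (hx1 t s ht hs).2, hx2 t s ht hs, e _ (add_nonneg ht hs)]
  · rw [← tendsto_zero_iff_norm_tendsto_zero] at hx4 ⊢
    have := hx4.const_smul c
    rw [smul_zero] at this
    refine this.congr' ?_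
    filter_upwards [self_mem_nhdsWithin] with t ht
    rw [e t (le_of_lt ht), smul_sub]

theorem mem_sigmaSpace_iff {ω : ℝ} {x : H} : x ∈ sigmaSpace T ω ↔
    x ∈ regularVectors T ∧ ∃ M : ℝ, ∀ t : ℝ, 0 ≤ t → ‖opApply (T t) x‖ ≤ M * Real.exp (ω * t) := by
  refine and_congr_right fun _ => ⟨fun ⟨M, hM⟩ => ⟨M, fun t ht => ?_⟩, fun ⟨M, hM⟩ => ⟨M, ?_⟩⟩
  · have : Real.exp (-(ω * t)) * ‖opApply (T t) x‖ ≤ M := hM ⟨t, ht, rfl⟩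
    rwa [Real.exp_neg, inv_mul_le_iff₀ (Real.exp_pos _), mul_comm] at this
  · rintro _ ⟨t, ht, rfl⟩
    change Real.exp _ * _ ≤ M
    rw [Real.exp_neg, inv_mul_le_iff₀ (Real.exp_pos _), mul_comm]
    exact hM t ht

theorem zero_mem_sigmaSpace {ω : ℝ} : (0 : H) ∈ sigmaSpace T ω :=
  mem_sigmaSpace_iff.2 ⟨zero_mem_regularVectors, 0, fun t _ => by simp [opApply_zero]⟩

theorem sigmaSpace.add {ω : ℝ} {x y : H} (hx : x ∈ sigmaSpace T ω) (hy : y ∈ sigmaSpace T ω) :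
    x + y ∈ sigmaSpace T ω := by
  rw [mem_sigmaSpace_iff] at *
  obtain ⟨hx, M, hM⟩ := hx
  obtain ⟨hy, N, hN⟩ := hy
  refine ⟨regularVectors.add hx hy, M + N, fun t ht => ?_⟩
  rw [opApply_add (regularVectors.mem_domain hx ht) (regularVectors.mem_domain hy ht), add_mul]
  exact norm_add_le_of_le (hM t ht) (hN t ht)

theorem sigmaSpace.smul {ω : ℝ} {x : H} (c : ℂ) (hx : x ∈ sigmaSpace T ω) :
    c • x ∈ sigmaSpace T ω := by
  rw [mem_sigmaSpace_iff] at *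
  obtain ⟨hx, M, hM⟩ := hx
  refine ⟨regularVectors.smul c hx, ‖c‖ * M, fun t ht => ?_⟩
  rw [opApply_smul c (regularVectors.mem_domain hx ht), norm_smul, mul_assoc]
  gcongr
  exact hM t ht

theorem sigmaSpace.sub {ω : ℝ} {x y : H} (hx : x ∈ sigmaSpace T ω) (hy : y ∈ sigmaSpace T ω) :
    x - y ∈ sigmaSpace T ω := by
  rw [sub_eq_add_neg, ← neg_one_smul ℂ]
  exact sigmaSpace.add hx (sigmaSpace.smul _ hy)

theorem sigmaSpace.mono {ω ω' : ℝ} (h : ω ≤ ω') {x : H} (hx : x ∈ sigmaSpace T ω) :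
    x ∈ sigmaSpace T ω' := by
  rw [mem_sigmaSpace_iff] at *
  obtain ⟨hx, M, hM⟩ := hx
  -- The bound at `t = 0` forces `M ≥ 0`, without which raising the exponent could fail.
  have hM0 : 0 ≤ M := by simpa using (norm_nonneg _).trans (hM 0 le_rfl)
  refine ⟨hx, M, fun t ht => (hM t ht).trans ?_⟩
  gcongr

/-- The integral `∫ₛ^∞ e^{-μt} T(t)x dt`. -/
noncomputable def laplaceTail (T : ℝ → H →ₗ.[ℂ] H) (μ : ℂ) (x : H) (s : ℝ) : H :=
  ∫ t in Set.Ioi s, exp (-(μ * t)) • opApply (T t) x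

theorem laplaceTail_zero (μ : ℂ) (x : H) : laplaceTail T μ x 0 = laplace T μ x := rfl

theorem norm_exp_smul_le {ω M : ℝ} {μ : ℂ} {y : H} {t : ℝ}
    (h : ‖y‖ ≤ M * Real.exp (ω * t)) :
    ‖exp (-(μ * t)) • y‖ ≤ M * Real.exp (-(μ.re - ω) * t) := by
  have e : Real.exp (-(μ.re - ω) * t) = Real.exp (-(μ.re * t)) * Real.exp (ω * t) := by
    rw [← Real.exp_add]; ring_nf
  rw [norm_smul, norm_exp, e, mul_left_comm]
  simp only [neg_re, re_mul_ofReal]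
  gcongr

theorem sigmaSpace.integrableOn {ω : ℝ} {μ : ℂ} {y : H} (hy : y ∈ sigmaSpace T ω)
    (hμ : ω < μ.re) {s : ℝ} (hs : 0 ≤ s) :
    IntegrableOn (fun t : ℝ => exp (-(μ * t)) • opApply (T t) y) (Set.Ioi s) := by
  refine IntegrableOn.mono_set ?_ (Set.Ioi_subset_Ioi hs)
  rw [mem_sigmaSpace_iff] at hy
  obtain ⟨hy, M, hM⟩ := hy
  refine Integrable.mono' (g := fun t : ℝ => M * Real.exp (-(μ.re - ω) * t))
    ((exp_neg_integrableOn_Ioi 0 (sub_pos.2 hμ)).const_mul M) ?_ ?_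
  · refine ContinuousOn.aestronglyMeasurable ?_ measurableSet_Ioi
    exact ContinuousOn.smul (by fun_prop) hy.2.2.1
  · refine (ae_restrict_iff' measurableSet_Ioi).2 (Filter.Eventually.of_forall fun t ht => ?_)
    exact norm_exp_smul_le (hM t (le_of_lt ht))

/-- Substitution `t ↦ r + t`. By the semigroup law the left side is what `T(r)` makes of the tail
from `s`. -/
theorem laplaceTail_shift (T : ℝ → H →ₗ.[ℂ] H) (μ : ℂ) (y : H) (r s : ℝ) :
    ∫ t in Set.Ioi s, exp (-(μ * t)) • opApply (T (r + t)) y =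
      exp (μ * r) • laplaceTail T μ y (r + s) := by
  have h := (measurePreserving_add_left volume r).setIntegral_preimage_emb
    (measurableEmbedding_addLeft r) (fun t : ℝ => exp (-(μ * t)) • opApply (T t) y)
    (Set.Ioi (r + s))
  rw [laplaceTail, ← h, ← integral_smul]
  have : (fun x => r + x) ⁻¹' Set.Ioi (r + s) = Set.Ioi s := by
    ext; simp
  rw [this]
  congr 1
  ext t
  rw [smul_smul, ← Complex.exp_add]
  congr 2
  push_cast
  ring

theorem integrableOn_shift {ω : ℝ} {μ : ℂ} {y : H} (hy : y ∈ sigmaSpace T ω)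
    (hμ : ω < μ.re) {r s : ℝ} (hr : 0 ≤ r) (hs : 0 ≤ s) :
    IntegrableOn (fun t : ℝ => exp (-(μ * t)) • opApply (T (r + t)) y) (Set.Ioi s) := by
  have h := (measurePreserving_add_left volume r).integrableOn_comp_preimage
    (measurableEmbedding_addLeft r) (f := fun t : ℝ => exp (-(μ * t)) • opApply (T t) y)
    (s := Set.Ioi (r + s))
  have h2 := (h.2 (sigmaSpace.integrableOn hy hμ (add_nonneg hr hs))).smul (exp (μ * r))
  have : (fun x => r + x) ⁻¹' Set.Ioi (r + s) = Set.Ioi s := by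
    ext; simp
  rw [this] at h2
  refine h2.congr (Filter.Eventually.of_forall fun t => ?_)
  simp only [Pi.smul_apply, Function.comp_apply]
  rw [smul_smul, ← Complex.exp_add]
  congr 2
  push_cast
  ring

/-- The tail is the whole integral minus a primitive. Extending the integrand by zero to `t ≤ 0`
makes it integrable on the line, so the primitive is continuous up to and including `0`. -/
theorem continuousOn_laplaceTail {ω : ℝ} {μ : ℂ} {y : H} (hy : y ∈ sigmaSpace T ω)
    (hμ : ω < μ.re) : ContinuousOn (laplaceTail T μ y) (Set.Ici 0) := by
  have h0 := sigmaSpace.integrableOn hy hμ (s := 0) le_rfl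
  set f := fun t : ℝ => exp (-(μ * t)) • opApply (T t) y with hf
  have h1 : Integrable ((Set.Ioi 0).indicator f) := (integrable_indicator_iff measurableSet_Ioi).2 h0
  have h2 : Continuous fun s => ∫ t in (0 : ℝ)..s, (Set.Ioi 0).indicator f t :=
    intervalIntegral.continuous_primitive (fun a b => h1.intervalIntegrable) 0
  refine ((continuous_const (y := ∫ t in Set.Ioi 0, f t)).sub h2).continuousOn.congr
    fun s hs => ?_
  have hs' : (0 : ℝ) ≤ s := hs
  have e : ∫ t in (0 : ℝ)..s, (Set.Ioi 0).indicator f t = ∫ t in (0 : ℝ)..s, f t :=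
    intervalIntegral.integral_congr_ae (Filter.Eventually.of_forall fun t ht => by
      rw [Set.uIoc_of_le hs'] at ht
      exact Set.indicator_of_mem (show t ∈ Set.Ioi 0 from ht.1) f)
  change ∫ t in Set.Ioi s, f t = _ - _
  dsimp only
  rw [e, eq_sub_iff_add_eq', intervalIntegral.integral_interval_add_Ioi h0 (h0.mono_set (Set.Ioi_subset_Ioi hs'))]

variable [CompleteSpace H] {C : Conjugation H}

theorem opApply_laplaceTail (hT : ∀ t : ℝ, 0 ≤ t → IsCSelfAdjoint C (T t)) {ω : ℝ} {μ : ℂ} {y : H}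
    (hy : y ∈ sigmaSpace T ω) (hμ : ω < μ.re) {r s : ℝ} (hr : 0 ≤ r) (hs : 0 ≤ s) :
    laplaceTail T μ y s ∈ (T r).domain ∧
      opApply (T r) (laplaceTail T μ y s) = exp (μ * r) • laplaceTail T μ y (r + s) := by
  rw [← laplaceTail_shift]
  refine (hT r hr).opApply_integral (sigmaSpace.integrableOn hy hμ hs) (integrableOn_shift hy hμ hr hs) ?_
  refine (ae_restrict_iff' measurableSet_Ioi).2 (Filter.Eventually.of_forall fun t ht => ?_)
  have ht' : 0 ≤ t := hs.trans (le_of_lt ht)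
  have h1 := (hy.1.1 r t hr ht').2
  refine ⟨(T r).domain.smul_mem _ h1, ?_⟩
  rw [opApply_smul _ h1, hy.1.2.1 r t hr ht']

/-- Everything is read off from `T(t)x = e^{μt} ∫_t^∞ e^{-μτ} T(τ)y dτ`. The bound `‖T(s + t)y‖ ≤ M
e^{ωs} e^{ωt}` under the shifted integral preserves the exponent `ω`. -/
theorem laplace_mem_sigmaSpace (hT : ∀ t : ℝ, 0 ≤ t → IsCSelfAdjoint C (T t)) {ω : ℝ} {μ : ℂ}
    {y : H} (hy : y ∈ sigmaSpace T ω) (hμ : ω < μ.re) : laplace T μ y ∈ sigmaSpace T ω := by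
  have key := fun {r s : ℝ} => opApply_laplaceTail hT hy hμ (r := r) (s := s)
  have e : ∀ t : ℝ, 0 ≤ t → opApply (T t) (laplace T μ y) = exp (μ * t) • laplaceTail T μ y t :=
    fun t ht => by simpa [laplaceTail_zero] using (key ht le_rfl).2
  have hc : ContinuousOn (fun t : ℝ => exp (μ * t) • laplaceTail T μ y t) (Set.Ici 0) :=
    ContinuousOn.smul (by fun_prop) (continuousOn_laplaceTail hy hμ)
  refine mem_sigmaSpace_iff.2 ⟨⟨fun t s ht hs => ⟨(key hs le_rfl).1, ?_⟩, fun t s ht hs => ?_,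
    (hc.mono Set.Ioi_subset_Ici_self).congr fun t ht => e t (le_of_lt ht), ?_⟩, ?_⟩
  · rw [e s hs]
    exact (T t).domain.smul_mem _ (key ht hs).1
  · rw [e s hs, opApply_smul _ (key ht hs).1, (key ht hs).2, smul_smul, ← Complex.exp_add,
      e _ (add_nonneg ht hs)]
    congr 2
    push_cast
    ring
  · rw [← tendsto_zero_iff_norm_tendsto_zero, ← sub_self (laplace T μ y)]
    refine Filter.Tendsto.sub_const ?_ _
    have h0 := (hc 0 Set.self_mem_Ici).tendsto.mono_left
      (nhdsWithin_mono 0 Set.Ioi_subset_Ici_self)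
    simp only [ofReal_zero, mul_zero, Complex.exp_zero, one_smul, laplaceTail_zero] at h0
    refine h0.congr' ?_
    filter_upwards [self_mem_nhdsWithin] with t ht
    exact (e t (le_of_lt ht)).symm
  · obtain ⟨-, M, hM⟩ := mem_sigmaSpace_iff.1 hy
    refine ⟨M * ∫ t in Set.Ioi (0 : ℝ), Real.exp (-(μ.re - ω) * t), fun s hs => ?_⟩
    have h1 := laplaceTail_shift T μ y s 0
    rw [add_zero] at h1
    rw [e s hs, ← h1, ← integral_const_mul, ← integral_mul_const]
    refine norm_integral_le_of_norm_le
      (((exp_neg_integrableOn_Ioi 0 (sub_pos.2 hμ)).const_mul M).mul_const _) ?_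
    refine (ae_restrict_iff' measurableSet_Ioi).2 (Filter.Eventually.of_forall fun t ht => ?_)
    have h2 := hM (s + t) (add_nonneg hs (le_of_lt ht))
    rw [mul_add, Real.exp_add, ← mul_assoc] at h2
    refine (norm_exp_smul_le h2).trans_eq ?_
    ring

theorem inner_laplace_comm (hT : ∀ t : ℝ, 0 ≤ t → IsCSelfAdjoint C (T t)) {ω : ℝ} {μ : ℂ}
    {u v : H} (hu : u ∈ sigmaSpace T ω) (hv : v ∈ sigmaSpace T ω) (hμ : ω < μ.re) :
    inner ℂ (C (laplace T μ u)) v = inner ℂ (C u) (laplace T μ v) := by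
  rw [C.inner_map_left, laplace, laplace, ← integral_inner (sigmaSpace.integrableOn hu hμ le_rfl),
    ← integral_inner (sigmaSpace.integrableOn hv hμ le_rfl)]
  refine setIntegral_congr_fun measurableSet_Ioi fun t ht => ?_
  have ht' : (0 : ℝ) ≤ t := le_of_lt ht
  have h1 := regularVectors.mem_domain hu.1 ht'
  have h2 := regularVectors.mem_domain hv.1 ht'
  simp only [inner_smul_right]
  rw [opApply_of_mem h1, opApply_of_mem h2, (hT t ht').isCSymmetric ⟨u, h1⟩ ⟨v, h2⟩,
    C.inner_map_left]

/-- The transform at `μ` acts as a resolvent, symmetric because each `T(t)` is; symmetry passes to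
`R` once both vectors are transforms at the same `μ`. -/
theorem isCSymmetric_of_laplace (hT : ∀ t : ℝ, 0 ≤ t → IsCSelfAdjoint C (T t))
    {R : H →ₗ.[ℂ] H} (hR : ∀ x : R.domain, ∃ ω : ℝ, ∀ μ : ℂ, ω < μ.re →
      ∃ u ∈ sigmaSpace T ω, (x : H) = laplace T μ u ∧ R x = μ • (x : H) - u) :
    IsCSymmetric C R := fun x y => by
  obtain ⟨ω₁, h₁⟩ := hR x
  obtain ⟨ω₂, h₂⟩ := hR y
  -- One parameter to the right of both growth exponents.
  have hμ : max ω₁ ω₂ < ((max ω₁ ω₂ + 1 : ℝ) : ℂ).re := by simp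
  obtain ⟨u, hu, hxu, hRx⟩ := h₁ _ ((le_max_left _ _).trans_lt hμ)
  obtain ⟨v, hv, hyv, hRy⟩ := h₂ _ ((le_max_right _ _).trans_lt hμ)
  have h := inner_laplace_comm hT (sigmaSpace.mono (le_max_left _ _) hu)
    (sigmaSpace.mono (le_max_right _ _) hv) hμ
  rw [← hxu, ← hyv] at h
  rw [hRx, hRy, C.map_sub, C.map_smul, inner_sub_left, inner_sub_right, inner_smul_left,
    inner_smul_right, h, conj_conj]

end Sigma

/-! ### Transport of a family and its generator by a conjugation. -/

section Conjugate

variable {T S : ℝ → H →ₗ.[ℂ] H} {C : Conjugation H}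

theorem conjOp_family_symm (h : ∀ t : ℝ, 0 ≤ t → S t = C.conjOp (T t)) :
    ∀ t : ℝ, 0 ≤ t → T t = C.conjOp (S t) := fun t ht => by rw [h t ht, C.conjOp_conjOp]

theorem opApply_conjOp_family (h : ∀ t : ℝ, 0 ≤ t → S t = C.conjOp (T t)) {t : ℝ} (ht : 0 ≤ t)
    (x : H) : opApply (S t) (C x) = C (opApply (T t) x) := by
  rw [h t ht, opApply_conjOp, C.apply_apply]

theorem map_mem_regularVectors (h : ∀ t : ℝ, 0 ≤ t → S t = C.conjOp (T t)) {x : H}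
    (hx : x ∈ regularVectors T) : C x ∈ regularVectors S := by
  have e := fun {t : ℝ} (ht : 0 ≤ t) x => opApply_conjOp_family h ht x
  have hd : ∀ t : ℝ, 0 ≤ t → ∀ x, x ∈ (T t).domain → C x ∈ (S t).domain := fun t ht x hx => by
    rwa [h t ht, C.mem_conjOp, C.apply_apply]
  obtain ⟨h1, h2, h3, h4⟩ := hx
  refine ⟨fun t s ht hs => ⟨hd s hs _ (h1 t s ht hs).1, ?_⟩, fun t s ht hs => ?_,
    (C.continuous.comp_continuousOn h3).congr fun t ht => e (le_of_lt ht) x, h4.congr' ?_⟩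
  · rw [e hs]
    exact hd t ht _ (h1 t s ht hs).2
  · rw [e hs, e ht, h2 t s ht hs, e (add_nonneg ht hs)]
  · filter_upwards [self_mem_nhdsWithin] with t ht
    rw [e (le_of_lt ht), ← C.map_sub, C.norm_map]

theorem map_mem_sigmaSpace (h : ∀ t : ℝ, 0 ≤ t → S t = C.conjOp (T t)) {ω : ℝ} {x : H}
    (hx : x ∈ sigmaSpace T ω) : C x ∈ sigmaSpace S ω := by
  obtain ⟨hx, M, hM⟩ := mem_sigmaSpace_iff.1 hx
  refine mem_sigmaSpace_iff.2 ⟨map_mem_regularVectors h hx, M, fun t ht => ?_⟩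
  rw [opApply_conjOp_family h ht, C.norm_map]
  exact hM t ht

theorem map_laplace (h : ∀ t : ℝ, 0 ≤ t → S t = C.conjOp (T t)) (μ : ℂ) (x : H) :
    C (laplace T μ x) = laplace S (conj μ) (C x) := by
  rw [laplace, laplace, ← C.integral_comp]
  refine setIntegral_congr_fun measurableSet_Ioi fun t ht => ?_
  rw [opApply_conjOp_family h (le_of_lt ht), C.map_smul, ← exp_conj]
  simp

theorem IsUnboundedC0Semigroup.map_conj (h : ∀ t : ℝ, 0 ≤ t → S t = C.conjOp (T t))
    (hT : IsUnboundedC0Semigroup T) : IsUnboundedC0Semigroup S := by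
  obtain ⟨x, hx, hx0⟩ := hT
  refine ⟨C x, map_mem_regularVectors h hx, fun h0 => hx0 ?_⟩
  rw [← C.apply_apply x, h0, C.map_zero]

/-- Antilinearity replaces `μ` by `conj μ`, which has the same real part, so the condition `ω < Re
μ` survives. The converse is the same argument, as `C` is an involution. -/
theorem IsGenerator.map_conj (h : ∀ t : ℝ, 0 ≤ t → S t = C.conjOp (T t)) {R : H →ₗ.[ℂ] H}
    (hR : IsGenerator T R) : IsGenerator S (C.conjOp R) := fun x z => by
  rw [C.mem_graph_conjOp, hR]
  constructor
  · rintro ⟨ω, μ, y, hμ, hy, hx, hz⟩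
    refine ⟨ω, conj μ, C y, by rwa [conj_re], map_mem_sigmaSpace h hy, ?_, ?_⟩
    · rw [← map_laplace h, ← hx, C.apply_apply]
    · rw [← C.apply_apply z, hz, C.map_sub, C.map_smul, C.apply_apply]
  · rintro ⟨ω, μ, y, hμ, hy, hx, hz⟩
    refine ⟨ω, conj μ, C y, by rwa [conj_re], map_mem_sigmaSpace (conjOp_family_symm h) hy, ?_, ?_⟩
    · rw [hx, map_laplace (conjOp_family_symm h)]
    · rw [hz, C.map_sub, C.map_smul]

/-- Generators are unique and `C R C` generates the adjoint family, so `R*` generating it would mean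
`R* = C R C`, which is `C`-selfadjointness. -/
theorem not_isGenerator_adjoint [CompleteSpace H]
    (hT : ∀ t : ℝ, 0 ≤ t → IsCSelfAdjoint C (T t)) {R : H →ₗ.[ℂ] H} (hR : IsGenerator T R)
    (hd : Dense (R.domain : Set H)) (hn : ¬ IsCSelfAdjoint C R) :
    ¬ IsGenerator (fun t => (T t).adjoint) R.adjoint := fun hg => by
  have h := hg.unique (hR.map_conj fun t ht => (hT t ht).adjoint_eq)
  exact hn ⟨hd, by rw [h, C.conjOp_conjOp]⟩

end Conjugate
end Abstract

/-! ### The generator as a differential operator, and its point spectrum. -/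

section WeightedComposition

variable {a b c ℓ G H : ℂ}

/-- Point evaluation as a bounded functional. -/
noncomputable def Fock.eval (z : ℂ) : Fock →L[ℂ] ℂ :=
  LinearMap.mkContinuous
    { toFun := fun f => f z, map_add' := fun _ _ => rfl, map_smul' := fun _ _ => rfl }
    (Real.exp (‖z‖ ^ 2 / 2)) fun f => Fock.norm_apply_le f z

@[simp] theorem Fock.eval_apply (z : ℂ) (f : Fock) : Fock.eval z f = f z := rfl

/-- The first order differential expression `(H - ℓ (aG + b) z) f + ℓ (z - G) f'`. -/
noncomputable def genExpr (a b ℓ G H : ℂ) (f : ℂ → ℂ) (z : ℂ) : ℂ :=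
  (H - ℓ * (a * G + b) * z) * f z + ℓ * (z - G) * deriv f z

theorem semicocycle_zero (z : ℂ) : semicocycle a b ℓ G H 0 z = 1 := by
  simp [semicocycle]

theorem semiflow_zero (z : ℂ) : semiflow ℓ G 0 z = z := by
  simp [semiflow]

theorem hasDerivAt_semiflow (z : ℂ) (t : ℝ) :
    HasDerivAt (fun t : ℝ => semiflow ℓ G t z) (ℓ * (semiflow ℓ G t z - G)) t := by
  have h1 : HasDerivAt (fun t : ℝ => exp (ℓ * t)) (exp (ℓ * t) * (ℓ * 1)) t :=
    (ofRealCLM.hasDerivAt.const_mul ℓ).cexp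
  refine ((h1.mul_const z).add ((h1.const_sub 1).const_mul G)).congr_deriv ?_
  simp only [semiflow]
  ring

theorem hasDerivAt_semicocycle (z : ℂ) (t : ℝ) :
    HasDerivAt (fun t : ℝ => semicocycle a b ℓ G H t z)
      (semicocycle a b ℓ G H t z * (H - ℓ * (a * G + b) * semiflow ℓ G t z)) t := by
  have h0 := ofRealCLM.hasDerivAt (x := t)
  have h1 : HasDerivAt (fun t : ℝ => exp (ℓ * t)) (exp (ℓ * t) * (ℓ * 1)) t :=
    (h0.const_mul ℓ).cexp
  have h2 := ((h0.const_mul H).add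
    (((h1.sub (h0.const_mul ℓ)).sub_const 1).const_mul (G * (a * G + b)))).cexp
  have h3 := (((h1.const_sub 1).const_mul (a * G + b)).const_mul z).cexp
  refine (h2.mul h3).congr_deriv ?_
  simp only [semiflow, semicocycle, ofRealCLM_apply, Pi.add_apply, Pi.sub_apply, ofReal_one]
  ring

/-- The flow solves `ζ' = ℓ(ζ - G)` and the cocycle `ξ' = ξ (H - ℓ(aG + b)ζ)`; the product and chain
rules assemble these into `genExpr` along the flow. -/
theorem hasDerivAt_wc {f : ℂ → ℂ} (hf : Differentiable ℂ f) (z : ℂ) (t : ℝ) :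
    HasDerivAt (fun t : ℝ => semicocycle a b ℓ G H t z * f (semiflow ℓ G t z))
      (semicocycle a b ℓ G H t z * genExpr a b ℓ G H f (semiflow ℓ G t z)) t := by
  have h := (hasDerivAt_semicocycle (a := a) (b := b) (ℓ := ℓ) (G := G) (H := H) z t).mul
    ((hf (semiflow ℓ G t z)).hasDerivAt.comp t (hasDerivAt_semiflow z t))
  refine h.congr_deriv ?_
  simp only [genExpr, Function.comp_apply]
  ring

theorem continuous_wc {f : ℂ → ℂ} (hf : Differentiable ℂ f) (z : ℂ) :
    Continuous fun t : ℝ => semicocycle a b ℓ G H t z * f (semiflow ℓ G t z) :=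
  continuous_iff_continuousAt.2 fun t => (hasDerivAt_wc hf z t).continuousAt

theorem opApply_wcMax_of_le {A : Fock →ₗ.[ℂ] Fock} {ψ φ : ℂ → ℂ} (h : A ≤ wcMax ψ φ) {f : Fock}
    (hf : f ∈ A.domain) (z : ℂ) : opApply A f z = ψ z * f (φ z) := by
  rw [opApply_of_mem hf, h.2 (y := ⟨f, h.1 hf⟩) rfl]
  rfl

variable {T : ℝ → Fock →ₗ.[ℂ] Fock}

theorem opApply_eq (hW : ∀ t : ℝ, 0 ≤ t → T t ≤ wcMax (semicocycle a b ℓ G H t) (semiflow ℓ G t))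
    {f : Fock} (hf : f ∈ regularVectors T) {t : ℝ} (ht : 0 ≤ t) (z : ℂ) :
    opApply (T t) f z = semicocycle a b ℓ G H t z * f (semiflow ℓ G t z) :=
  opApply_wcMax_of_le (hW t ht) (regularVectors.mem_domain hf ht) z

theorem laplaceTail_apply
    (hW : ∀ t : ℝ, 0 ≤ t → T t ≤ wcMax (semicocycle a b ℓ G H t) (semiflow ℓ G t))
    {ω : ℝ} {μ : ℂ} {y : Fock} (hy : y ∈ sigmaSpace T ω) (hμ : ω < μ.re) {s : ℝ} (hs : 0 ≤ s)
    (z : ℂ) :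
    IntegrableOn (fun t : ℝ => exp (-(μ * t)) *
      (semicocycle a b ℓ G H t z * y (semiflow ℓ G t z))) (Set.Ioi s) ∧
    laplaceTail T μ y s z = ∫ t in Set.Ioi s, exp (-(μ * t)) *
      (semicocycle a b ℓ G H t z * y (semiflow ℓ G t z)) := by
  have hi := sigmaSpace.integrableOn hy hμ hs
  have he : Set.EqOn (fun t : ℝ => Fock.eval z (exp (-(μ * t)) • opApply (T t) y))
      (fun t : ℝ => exp (-(μ * t)) * (semicocycle a b ℓ G H t z * y (semiflow ℓ G t z)))
      (Set.Ioi s) := fun t ht => by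
    simp [opApply_eq hW hy.1 (hs.trans (le_of_lt ht))]
  refine ⟨IntegrableOn.congr_fun ((Fock.eval z).integrable_comp hi) he measurableSet_Ioi, ?_⟩
  rw [← setIntegral_congr_fun measurableSet_Ioi he, (Fock.eval z).integral_comp_comm hi]
  rfl

theorem norm_wc_le (hW : ∀ t : ℝ, 0 ≤ t → T t ≤ wcMax (semicocycle a b ℓ G H t) (semiflow ℓ G t))
    {ω : ℝ} {f : Fock} (hf : f ∈ sigmaSpace T ω) (z : ℂ) :
    ∃ M : ℝ, ∀ t : ℝ, 0 ≤ t →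
      ‖semicocycle a b ℓ G H t z * f (semiflow ℓ G t z)‖ ≤ M * Real.exp (ω * t) := by
  obtain ⟨h, M, hM⟩ := mem_sigmaSpace_iff.1 hf
  refine ⟨Real.exp (‖z‖ ^ 2 / 2) * M, fun t ht => ?_⟩
  rw [← opApply_eq hW h ht, mul_assoc]
  refine (Fock.norm_apply_le _ _).trans ?_
  gcongr
  exact hM t ht

/-- At each `z` the integrand is the derivative of `-e^{-μt} ξ_t(z) f(ζ_t(z))`, which tends to `0`
because `Re μ > ω` and equals `-f(z)` at `t = 0`. -/
theorem laplace_of_genExpr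
    (hW : ∀ t : ℝ, 0 ≤ t → T t ≤ wcMax (semicocycle a b ℓ G H t) (semiflow ℓ G t))
    {ω : ℝ} {μ : ℂ} {f g : Fock} (hf : f ∈ sigmaSpace T ω) (hg : g ∈ sigmaSpace T ω)
    (hfg : ∀ z, g z = genExpr a b ℓ G H f z) (hμ : ω < μ.re) :
    laplace T μ (μ • f - g) = f := by
  have hy : μ • f - g ∈ sigmaSpace T ω := sigmaSpace.sub (sigmaSpace.smul μ hf) hg
  ext z
  obtain ⟨h1, h2⟩ := laplaceTail_apply hW hy hμ le_rfl z
  rw [← laplaceTail_zero, h2]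
  have hd : ∀ t : ℝ, HasDerivAt
      (fun t : ℝ => -(exp (-(μ * t)) * (semicocycle a b ℓ G H t z * f (semiflow ℓ G t z))))
      (exp (-(μ * t)) * (semicocycle a b ℓ G H t z * (μ • f - g) (semiflow ℓ G t z))) t := by
    intro t
    have h3 : HasDerivAt (fun t : ℝ => exp (-(μ * t))) (exp (-(μ * t)) * -(μ * 1)) t :=
      ((ofRealCLM.hasDerivAt.const_mul μ).neg).cexp
    refine (h3.mul (hasDerivAt_wc f.differentiable z t)).neg.congr_deriv ?_
    simp only [Fock.sub_apply, Fock.smul_apply, hfg]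
    ring
  have hlim : Filter.Tendsto
      (fun t : ℝ => -(exp (-(μ * t)) * (semicocycle a b ℓ G H t z * f (semiflow ℓ G t z))))
      Filter.atTop (𝓝 0) := by
    obtain ⟨M, hM⟩ := norm_wc_le hW hf z
    have h4 : Filter.Tendsto (fun t : ℝ => M * Real.exp (-((μ.re - ω) * t))) Filter.atTop
        (𝓝 (M * 0)) :=
      (Real.tendsto_exp_neg_atTop_nhds_zero.comp
        (Filter.tendsto_id.const_mul_atTop (sub_pos.2 hμ))).const_mul M
    rw [mul_zero] at h4
    refine squeeze_zero_norm' ?_ h4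
    filter_upwards [Filter.eventually_ge_atTop 0] with t ht
    rw [norm_neg, ← neg_mul (μ.re - ω)]
    exact norm_exp_smul_le (hM t ht)
  rw [integral_Ioi_of_hasDerivAt_of_tendsto' (fun t _ => hd t) h1 hlim]
  simp [semicocycle_zero, semiflow_zero]

/-- The function `s ↦ (T(s)x)(z)` has two formulas: `ξ_s x(ζ_s)`, with derivative `genExpr x` at
`0`, and `e^{μs}` times the Laplace tail, with derivative `μ x - y`. -/
theorem genExpr_laplace
    (hW : ∀ t : ℝ, 0 ≤ t → T t ≤ wcMax (semicocycle a b ℓ G H t) (semiflow ℓ G t))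
    {C : Conjugation Fock} (hT : ∀ t : ℝ, 0 ≤ t → IsCSelfAdjoint C (T t))
    {ω : ℝ} {μ : ℂ} {y : Fock} (hy : y ∈ sigmaSpace T ω) (hμ : ω < μ.re) (z : ℂ) :
    genExpr a b ℓ G H (laplace T μ y : Fock) z = (μ • laplace T μ y - y) z := by
  set x := laplace T μ y with hx
  have hxs : x ∈ sigmaSpace T ω := laplace_mem_sigmaSpace hT hy hμ
  set k : ℝ → ℂ := fun t => exp (-(μ * t)) *
    (semicocycle a b ℓ G H t z * y (semiflow ℓ G t z)) with hk
  have hkc : Continuous k := by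
    have := continuous_wc (a := a) (b := b) (ℓ := ℓ) (G := G) (H := H) y.differentiable z
    fun_prop
  have h1 : HasDerivAt (fun t : ℝ => semicocycle a b ℓ G H t z * x (semiflow ℓ G t z))
      (genExpr a b ℓ G H x z) 0 := by
    simpa [semicocycle_zero, semiflow_zero] using
      hasDerivAt_wc (a := a) (b := b) (ℓ := ℓ) (G := G) (H := H) x.differentiable z 0
  have h2 : HasDerivAt (fun s : ℝ => exp (μ * s) * (x z - ∫ t in (0 : ℝ)..s, k t))
      (μ * x z - y z) 0 := by
    have h3 : HasDerivAt (fun s : ℝ => exp (μ * s)) (exp (μ * (0 : ℝ)) * (μ * 1)) 0 :=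
      (ofRealCLM.hasDerivAt.const_mul μ).cexp
    have h4 := (intervalIntegral.integral_hasDerivAt_right (hkc.intervalIntegrable 0 0)
      hkc.stronglyMeasurable.stronglyMeasurableAtFilter hkc.continuousAt).const_sub (x z)
    refine (h3.mul h4).congr_deriv ?_
    simp [hk, semicocycle_zero, semiflow_zero]
    ring
  have he : ∀ s ∈ Set.Ici (0 : ℝ), semicocycle a b ℓ G H s z * x (semiflow ℓ G s z) =
      exp (μ * s) * (x z - ∫ t in (0 : ℝ)..s, k t) := by
    intro s hs
    have hs' : (0 : ℝ) ≤ s := hs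
    obtain ⟨i0, e0⟩ := laplaceTail_apply hW hy hμ le_rfl z
    have h5 := (opApply_laplaceTail hT hy hμ hs' le_rfl).2
    rw [laplaceTail_zero, ← hx, add_zero] at h5
    rw [← opApply_eq hW hxs.1 hs', h5, Fock.smul_apply, (laplaceTail_apply hW hy hμ hs' z).2, hx,
      ← laplaceTail_zero, e0]
    congr 1
    rw [eq_sub_iff_add_eq']
    exact intervalIntegral.integral_interval_add_Ioi i0 (i0.mono_set (Set.Ioi_subset_Ioi hs'))
  -- The two formulas agree only for `s ≥ 0`, so the comparison is of one-sided derivatives.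
  have h6 : HasDerivWithinAt (fun t : ℝ => semicocycle a b ℓ G H t z * x (semiflow ℓ G t z))
      (μ * x z - y z) (Set.Ici 0) 0 :=
    h2.hasDerivWithinAt.congr he (he 0 Set.self_mem_Ici)
  exact (uniqueDiffOn_Ici (0 : ℝ) 0 Set.self_mem_Ici).eq_deriv _ h1.hasDerivWithinAt h6

theorem genExpr_add {f g : ℂ → ℂ} (hf : Differentiable ℂ f) (hg : Differentiable ℂ g) (z : ℂ) :
    genExpr a b ℓ G H (f + g) z = genExpr a b ℓ G H f z + genExpr a b ℓ G H g z := by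
  rw [genExpr, deriv_add (hf z) (hg z), Pi.add_apply, genExpr, genExpr]
  ring

theorem genExpr_smul {f : ℂ → ℂ} (hf : Differentiable ℂ f) (r z : ℂ) :
    genExpr a b ℓ G H (r • f) z = r * genExpr a b ℓ G H f z := by
  rw [genExpr, deriv_const_smul r (hf z), Pi.smul_apply, genExpr, smul_eq_mul, smul_eq_mul]
  ring

variable (a b ℓ G H T) in
/-- The differential expression `genExpr` on the vectors `f` for which `f` and `genExpr f` lie in
a common space `sigmaSpace T ω`. -/
noncomputable def genOp : Fock →ₗ.[ℂ] Fock where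
  domain :=
    { carrier := ⋃ ω : ℝ, {f | f ∈ sigmaSpace T ω ∧ ∃ g ∈ sigmaSpace T ω, ∀ z : ℂ,
        g z = genExpr a b ℓ G H f z}
      add_mem' := fun {f₁ f₂} h₁ h₂ => by
        obtain ⟨ω₁, hf₁, g₁, hg₁, e₁⟩ := Set.mem_iUnion.1 h₁
        obtain ⟨ω₂, hf₂, g₂, hg₂, e₂⟩ := Set.mem_iUnion.1 h₂
        refine Set.mem_iUnion.2 ⟨max ω₁ ω₂, sigmaSpace.add (sigmaSpace.mono (le_max_left _ _) hf₁)
          (sigmaSpace.mono (le_max_right _ _) hf₂), g₁ + g₂,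
          sigmaSpace.add (sigmaSpace.mono (le_max_left _ _) hg₁)
            (sigmaSpace.mono (le_max_right _ _) hg₂), fun z => ?_⟩
        rw [Fock.add_apply, e₁, e₂, ← genExpr_add f₁.differentiable f₂.differentiable]
        rfl
      zero_mem' := Set.mem_iUnion.2 ⟨0, zero_mem_sigmaSpace, 0, zero_mem_sigmaSpace, fun z => by
        have e : ((0 : Fock) : ℂ → ℂ) = fun _ => 0 := rfl
        simp [genExpr, e]⟩
      smul_mem' := fun r f h => by
        obtain ⟨ω, hf, g, hg, e⟩ := Set.mem_iUnion.1 h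
        refine Set.mem_iUnion.2 ⟨ω, sigmaSpace.smul r hf, r • g, sigmaSpace.smul r hg, fun z => ?_⟩
        rw [Fock.smul_apply, e, ← genExpr_smul f.differentiable]
        rfl }
  toFun :=
    { toFun := fun f => Fock.mk (genExpr a b ℓ G H (f : Fock)) (by
        obtain ⟨ω, hf, g, hg, e⟩ := Set.mem_iUnion.1 f.2
        rw [← funext e]
        exact g.2)
      map_add' := fun f g => by
        ext z
        exact genExpr_add (f : Fock).differentiable (g : Fock).differentiable z
      map_smul' := fun r f => by
        ext z
        exact genExpr_smul (f : Fock).differentiable r z }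

theorem genOp_apply (f : (genOp a b ℓ G H T).domain) (z : ℂ) :
    genOp a b ℓ G H T f z = genExpr a b ℓ G H (f : Fock) z := rfl

theorem mem_genOp_domain {f : Fock} : f ∈ (genOp a b ℓ G H T).domain ↔
    ∃ ω : ℝ, f ∈ sigmaSpace T ω ∧ ∃ g ∈ sigmaSpace T ω, ∀ z : ℂ, g z = genExpr a b ℓ G H f z :=
  Set.mem_iUnion

/-- The preimage is `u = μ x - genExpr x`. Having it for every `μ` beyond `ω` is what lets two
vectors share a parameter in the symmetry proof. -/
theorem genOp_eq_laplace
    (hW : ∀ t : ℝ, 0 ≤ t → T t ≤ wcMax (semicocycle a b ℓ G H t) (semiflow ℓ G t))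
    (x : (genOp a b ℓ G H T).domain) : ∃ ω : ℝ, ∀ μ : ℂ, ω < μ.re → ∃ u ∈ sigmaSpace T ω,
      (x : Fock) = laplace T μ u ∧ genOp a b ℓ G H T x = μ • (x : Fock) - u := by
  obtain ⟨ω, hf, g, hg, e⟩ := mem_genOp_domain.1 x.2
  refine ⟨ω, fun μ hμ => ⟨μ • (x : Fock) - g, sigmaSpace.sub (sigmaSpace.smul μ hf) hg,
    (laplace_of_genExpr hW hf hg e hμ).symm, ?_⟩⟩
  rw [sub_sub_cancel]
  ext z
  rw [e, genOp_apply]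

theorem isGenerator_genOp
    (hW : ∀ t : ℝ, 0 ≤ t → T t ≤ wcMax (semicocycle a b ℓ G H t) (semiflow ℓ G t))
    {C : Conjugation Fock} (hT : ∀ t : ℝ, 0 ≤ t → IsCSelfAdjoint C (T t)) :
    IsGenerator T (genOp a b ℓ G H T) := fun x z => by
  rw [LinearPMap.mem_graph_iff]
  constructor
  · rintro ⟨x, rfl, rfl⟩
    obtain ⟨ω, h⟩ := genOp_eq_laplace hW x
    obtain ⟨u, hu, h1, h2⟩ := h (ω + 1 : ℝ) (by simp)
    exact ⟨ω, (ω + 1 : ℝ), u, by simp, hu, h1, h2⟩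
  · rintro ⟨ω, μ, y, hμ, hy, rfl, rfl⟩
    have hx := laplace_mem_sigmaSpace hT hy hμ
    have e := genExpr_laplace hW hT hy hμ
    exact ⟨⟨laplace T μ y, mem_genOp_domain.2 ⟨ω, hx, μ • laplace T μ y - y,
      sigmaSpace.sub (sigmaSpace.smul μ hx) hy, fun z => (e z).symm⟩⟩, rfl, Fock.ext e⟩

theorem isCSymmetric_genOp
    (hW : ∀ t : ℝ, 0 ≤ t → T t ≤ wcMax (semicocycle a b ℓ G H t) (semiflow ℓ G t))
    {C : Conjugation Fock} (hT : ∀ t : ℝ, 0 ≤ t → IsCSelfAdjoint C (T t)) :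
    IsCSymmetric C (genOp a b ℓ G H T) :=
  isCSymmetric_of_laplace hT (genOp_eq_laplace hW)

/-- An entire eigenfunction of `genExpr` that does not vanish identically belongs to an eigenvalue
determined by its order of vanishing at `G`. -/
theorem eigenvalue_of_genExpr {f : ℂ → ℂ} (hf : Differentiable ℂ f) {w : ℂ} (hw : f w ≠ 0) {η : ℂ}
    (h : ∀ z, genExpr a b ℓ G H f z = η * f z) :
    ∃ k : ℕ, η = H - ℓ * (a * G + b) * G + k * ℓ := by
  have hG : AnalyticAt ℂ f G := hf.analyticAt G
  have hne : ¬ ∀ᶠ z in 𝓝 G, f z = 0 := fun h0 =>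
    hw (congrFun ((hf.differentiableOn.analyticOnNhd isOpen_univ).eq_of_eventuallyEq
      (g := fun _ => 0) analyticOnNhd_const h0) w)
  -- Here `n` is the order of the zero at `G`: locally `f = (z - G)^n g` with `g(G) ≠ 0`.
  obtain ⟨n, g, hg, hg0, hfg⟩ := hG.exists_eventuallyEq_pow_smul_nonzero_iff.2 hne
  refine ⟨n, ?_⟩
  have hd : ∀ᶠ z in 𝓝 G, (z - G) ^ n *
      ((H - ℓ * (a * G + b) * z + n * ℓ - η) * g z + ℓ * (z - G) * deriv g z) = 0 := by
    filter_upwards [hfg.eventually_nhds, hg.eventually_analyticAt] with z hz hgz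
    have h1 : HasDerivAt (fun z => (z - G) ^ n • g z)
        ((n * (z - G) ^ (n - 1) * 1) * g z + (z - G) ^ n * deriv g z) z :=
      (((hasDerivAt_id z).sub_const G).pow n).mul hgz.differentiableAt.hasDerivAt
    have h2 := Filter.EventuallyEq.deriv_eq hz
    rw [h1.deriv] at h2
    have h3 := h z
    -- For `n = 0` the truncated exponent is harmless, since the coefficient vanishes.
    have h4 : (n : ℂ) * (z - G) ^ (n - 1) * (z - G) = n * (z - G) ^ n := by
      rcases n with _ | n
      · simp
      · rw [Nat.add_sub_cancel, mul_assoc, ← pow_succ]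
    rw [genExpr, h2, hz.self_of_nhds, smul_eq_mul] at h3
    linear_combination h3 - ℓ * g z * h4
  have hd' : ∀ᶠ z in 𝓝[≠] G,
      (H - ℓ * (a * G + b) * z + n * ℓ - η) * g z + ℓ * (z - G) * deriv g z = 0 := by
    filter_upwards [hd.filter_mono nhdsWithin_le_nhds, self_mem_nhdsWithin] with z hz hzG
    exact (mul_eq_zero.1 hz).resolve_left (pow_ne_zero _ (sub_ne_zero.2 hzG))
  have hc : ContinuousAt (fun z =>
      (H - ℓ * (a * G + b) * z + n * ℓ - η) * g z + ℓ * (z - G) * deriv g z) G := by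
    have h1 := hg.continuousAt
    have h2 := hg.deriv.continuousAt
    fun_prop
  -- Dividing by `(z - G)^n` is legitimate only off `G`; continuity extends the equation to `G`,
  -- where the term with `deriv g` drops out.
  have h0 := tendsto_nhds_unique (hc.tendsto.mono_left nhdsWithin_le_nhds)
    (tendsto_const_nhds.congr' (hd'.mono fun z hz => hz.symm))
  simp only [sub_self, mul_zero, zero_mul, add_zero] at h0
  linear_combination -(mul_eq_zero.1 h0).resolve_right hg0

theorem pointSpectrum_genOp : pointSpectrum (genOp a b ℓ G H T) ⊆
    {η | ∃ k : ℕ, η = H - ℓ * (a * G + b) * G + k * ℓ} := by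
  rintro η ⟨x, hx0, hx⟩
  obtain ⟨w, hw⟩ : ∃ w, (x : Fock) w ≠ 0 := by
    by_contra! h
    exact hx0 (Fock.ext h)
  refine eigenvalue_of_genExpr (x : Fock).differentiable hw fun z => ?_
  rw [← genOp_apply, hx, Fock.smul_apply]

end WeightedComposition

/-! ### Exponential polynomials: pairings, totality and domains. -/

section ExpPolynomials

/-- Since `r|z| ≤ r²/2 + |z|²/2`, half of the Gaussian exponent remains as an integrable majorant.
-/
theorem integrable_exp_norm (r : ℝ) : Integrable (fun z : ℂ => Real.exp (r * ‖z‖)) gaussian := by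
  rw [Fock.integrable_gaussian]
  have h := (GaussianFourier.integrable_cexp_neg_mul_sq_norm_add (V := ℂ) (b := 1 / 2)
    (by norm_num) 0 0).norm
  have h2 := h.const_mul (Real.pi⁻¹ * Real.exp (r ^ 2 / 2))
  refine h2.mono' (by fun_prop) (Filter.Eventually.of_forall fun z => ?_)
  rw [norm_exp, smul_eq_mul, Real.norm_of_nonneg (by positivity), mul_assoc, mul_assoc,
    ← Real.exp_add, ← Real.exp_add]
  have e : (-(1 / 2 : ℂ) * (‖z‖ : ℂ) ^ 2 + 0 * ((inner ℝ 0 z : ℝ) : ℂ)).re = -(1 / 2) * ‖z‖ ^ 2 := by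
    have : (-(1 / 2 : ℂ) * (‖z‖ : ℂ) ^ 2 + 0 * ((inner ℝ 0 z : ℝ) : ℂ)) =
      ((-(1 / 2) * ‖z‖ ^ 2 : ℝ) : ℂ) := by push_cast; ring
    rw [this, ofReal_re]
  rw [e]
  refine mul_le_mul_of_nonneg_left (Real.exp_le_exp.2 ?_) (by positivity)
  nlinarith [sq_nonneg (r - ‖z‖)]

theorem memLp_exp_norm (r : ℝ) : MemLp (fun z : ℂ => Real.exp (r * ‖z‖)) 2 gaussian := by
  rw [memLp_two_iff_integrable_sq_norm (by fun_prop)]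
  refine (integrable_exp_norm (2 * r)).congr (Filter.Eventually.of_forall fun z => ?_)
  simp only [Real.norm_eq_abs, Real.abs_exp]
  rw [← Real.exp_nat_mul]
  push_cast
  ring_nf

theorem memFock_of_norm_le {f : ℂ → ℂ} (hf : Differentiable ℂ f) {r M : ℝ}
    (h : ∀ z, ‖f z‖ ≤ M * Real.exp (r * ‖z‖)) : MemFock f :=
  ⟨hf, ((memLp_exp_norm r).const_mul M).mono' hf.continuous.aestronglyMeasurable
    (Filter.Eventually.of_forall h)⟩

theorem norm_exp_mul_le (U z : ℂ) : ‖exp (U * z)‖ ≤ Real.exp (‖U‖ * ‖z‖) := by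
  rw [norm_exp, ← norm_mul]
  gcongr
  exact re_le_norm _

theorem norm_expPoly_le (U w z : ℂ) (k : ℕ) : ‖(z - w) ^ k * exp (U * z)‖ ≤
    k.factorial * Real.exp ‖w‖ * Real.exp ((1 + ‖U‖) * ‖z‖) := by
  have h1 : ‖z - w‖ ^ k ≤ k.factorial * Real.exp ‖z - w‖ := by
    have := Real.pow_div_factorial_le_exp ‖z - w‖ (norm_nonneg _) k
    rwa [div_le_iff₀' (by positivity)] at this
  have h2 : Real.exp ‖z - w‖ ≤ Real.exp ‖w‖ * Real.exp ‖z‖ := by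
    rw [← Real.exp_add, add_comm]
    gcongr
    exact norm_sub_le _ _
  rw [norm_mul, norm_pow, add_mul, one_mul, Real.exp_add]
  calc ‖z - w‖ ^ k * ‖exp (U * z)‖
      ≤ (k.factorial * (Real.exp ‖w‖ * Real.exp ‖z‖)) * Real.exp (‖U‖ * ‖z‖) := by
        gcongr
        · exact h1.trans (by gcongr)
        · exact norm_exp_mul_le U z
    _ = _ := by ring

/-- The function `(z - w)ᵏ e^{Uz}`. -/
noncomputable def expPoly (U w : ℂ) (k : ℕ) : Fock :=
  Fock.mk (fun z => (z - w) ^ k * exp (U * z))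
    (memFock_of_norm_le (by fun_prop) fun z => norm_expPoly_le U w z k)

theorem expPoly_apply (U w : ℂ) (k : ℕ) (z : ℂ) :
    expPoly U w k z = (z - w) ^ k * exp (U * z) := rfl

/-- The reproducing property of the kernels `e^{Uz}`. -/
theorem inner_expPoly_zero (U w : ℂ) (g : Fock) : inner ℂ (expPoly U w 0) g = g (conj U) := by
  obtain ⟨h1, -⟩ := Fock.translate_memLp g (conj U)
  have hd := g.differentiable
  have h3 := Fock.integral_gaussian_eq _ (by fun_prop) (h1.integrable one_le_two)
  simp only [add_zero, zero_mul, neg_zero, Complex.exp_zero, mul_one] at h3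
  -- Translation by `conj U` completes the square, reducing the pairing to the Gaussian mean of
  -- `g(conj U + z) e^{-zU}`, which is its value at `0`.
  rw [← h3, Fock.inner_def, Fock.integral_gaussian, Fock.integral_gaussian,
    ← integral_add_left_eq_self _ (conj U)]
  refine integral_congr_ae (Filter.Eventually.of_forall fun z => ?_)
  simp only [expPoly_apply, pow_zero, one_mul, conj_conj, real_smul]
  push_cast
  have h : (‖conj U + z‖ : ℂ) ^ 2 = (‖z‖ : ℂ) ^ 2 + conj U * U + conj U * conj z + z * U := by
    rw [← mul_conj', ← mul_conj' z]
    simp only [map_add, conj_conj]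
    ring
  have e : exp (-(‖conj U + z‖ : ℂ) ^ 2) * conj (exp (U * (conj U + z))) =
      exp (-(‖z‖ : ℂ) ^ 2) * exp (-(z * U)) := by
    rw [← exp_conj, ← Complex.exp_add, ← Complex.exp_add, h]
    simp only [map_add, map_mul, conj_conj]
    ring_nf
  linear_combination (Real.pi : ℂ)⁻¹ * g (conj U + z) * e

/-- Generating function: summing `(conj ε)^k (z - w)^k e^{Uz} / k!` gives a multiple of the kernel
`e^{(U + conj ε)z}`, and the reproducing property evaluates `g`. Pairings with exponential
polynomials are thus `k!` times Taylor coefficients. -/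
theorem hasSum_inner_expPoly (U w : ℂ) (g : Fock) (ε : ℂ) :
    HasSum (fun k : ℕ => ((k.factorial : ℂ)⁻¹ * inner ℂ (expPoly U w k) g) * ε ^ k)
      (exp (-(ε * conj w)) * g (conj U + ε)) := by
  have e0 : exp (-(ε * conj w)) * g (conj U + ε) =
      ∫ z, conj (exp (conj ε * (z - w)) * exp (U * z)) * g z ∂gaussian := by
    have h := inner_expPoly_zero (U + conj ε) 0 g
    rw [map_add, conj_conj] at h
    rw [← h, Fock.inner_def, ← integral_const_mul]
    refine integral_congr_ae (Filter.Eventually.of_forall fun z => ?_)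
    simp only [expPoly_apply, pow_zero, one_mul, ← exp_conj, map_mul]
    rw [← mul_assoc, ← Complex.exp_add, ← Complex.exp_add]
    simp only [map_add, map_sub, conj_conj]
    ring_nf
  rw [e0]
  have e1 : (fun k : ℕ => ((k.factorial : ℂ)⁻¹ * inner ℂ (expPoly U w k) g) * ε ^ k) =
      fun k : ℕ => ∫ z, conj ((conj ε * (z - w)) ^ k / k.factorial * exp (U * z)) * g z ∂gaussian := by
    ext k
    rw [Fock.inner_def, ← integral_const_mul, ← integral_mul_const]
    refine integral_congr_ae (Filter.Eventually.of_forall fun z => ?_)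
    simp only [expPoly_apply, map_mul, map_div₀, map_pow, conj_conj, map_natCast, mul_pow]
    ring
  rw [e1]
  have hexp : ∀ x : ℂ, HasSum (fun k : ℕ => x ^ k / k.factorial) (exp x) := fun x => by
    rw [exp_eq_exp_ℂ]; exact NormedSpace.expSeries_div_hasSum_exp x
  have hexpR : ∀ x : ℝ, HasSum (fun k : ℕ => x ^ k / k.factorial) (Real.exp x) := fun x => by
    rw [Real.exp_eq_exp_ℝ]; exact NormedSpace.expSeries_div_hasSum_exp x
  have hg := g.differentiable.continuous
  -- The termwise norms sum to `e^{|ε||z - w|} |e^{Uz}| |g|`, a product of two `L²` functions.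
  refine hasSum_integral_of_dominated_convergence
    (fun k z => (‖ε‖ * ‖z - w‖) ^ k / k.factorial * (‖exp (U * z)‖ * ‖g z‖))
    (fun k => Continuous.aestronglyMeasurable (by fun_prop)) (fun k => ?_) ?_ ?_ ?_
  · refine Filter.Eventually.of_forall fun z => le_of_eq ?_
    rw [norm_mul, norm_conj, norm_mul, norm_div, norm_pow, norm_mul, norm_conj, norm_natCast]
    ring
  · exact Filter.Eventually.of_forall fun z => ((hexpR _).mul_right _).summable
  · have e2 : (fun z => ∑' k : ℕ, (‖ε‖ * ‖z - w‖) ^ k / k.factorial * (‖exp (U * z)‖ * ‖g z‖)) =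
        fun z => Real.exp (‖ε‖ * ‖z - w‖) * ‖exp (U * z)‖ * ‖g z‖ := by
      ext z
      rw [((hexpR _).mul_right _).tsum_eq, mul_assoc]
    rw [e2]
    have h1 : MemLp (fun z => Real.exp (‖ε‖ * ‖z - w‖) * ‖exp (U * z)‖) 2 gaussian := by
      refine ((memLp_exp_norm (‖ε‖ + ‖U‖)).const_mul (Real.exp (‖ε‖ * ‖w‖))).mono'
        (Continuous.aestronglyMeasurable (by fun_prop)) (Filter.Eventually.of_forall fun z => ?_)
      rw [Real.norm_of_nonneg (by positivity), add_mul, Real.exp_add, ← mul_assoc, ← Real.exp_add]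
      gcongr
      · rw [← mul_add, add_comm]
        gcongr
        exact norm_sub_le _ _
      · exact norm_exp_mul_le U z
    exact h1.integrable_mul g.memLp.norm
  · refine Filter.Eventually.of_forall fun z => ?_
    exact ((hasSum_conj'.2 (by simpa using (hexp (conj ε * (z - w))).mul_right (exp (U * z)))).mul_right (g z))

/-- Cauchy's estimate for the coefficients of an everywhere convergent power series. -/
theorem norm_coeff_le_of_hasSum {F : ℂ → ℂ} (hF : Differentiable ℂ F) {q : ℕ → ℂ}
    (h : ∀ z, HasSum (fun n => q n * z ^ n) (F z)) {M : ℝ} (hM : ∀ z, ‖z‖ = 1 → ‖F z‖ ≤ M) (k : ℕ) :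
    ‖q k‖ ≤ M := by
  have hp : HasFPowerSeriesOnBall F (FormalMultilinearSeries.ofScalars ℂ q) 0 2 := by
    refine ⟨?_, by norm_num, fun {y} _ => ?_⟩
    · refine FormalMultilinearSeries.le_radius_of_summable _ (r := 2) ?_
      exact ((h 2).summable.norm).congr fun n => by simp
    · simpa [FormalMultilinearSeries.ofScalars_apply_eq, mul_comm] using h y
  have hc := (hF.differentiableOn (s := Metric.closedBall 0 1)).hasFPowerSeriesOnBall
    (R := 1) one_pos
  have h1 : ‖q k‖ = ‖cauchyPowerSeries F 0 (1 : NNReal) k‖ := by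
    -- Uniqueness of power series identifies `q k` with the Cauchy integral over the unit circle.
    rw [← hp.hasFPowerSeriesAt.eq_formalMultilinearSeries hc.hasFPowerSeriesAt,
      FormalMultilinearSeries.ofScalars_norm]
  rw [h1]
  refine (norm_cauchyPowerSeries_le F 0 _ k).trans ?_
  have h2 := intervalIntegral.norm_integral_le_of_norm_le_const (a := 0) (b := 2 * Real.pi)
    (f := fun θ => ‖F (circleMap 0 (1 : NNReal) θ)‖) (C := M) fun θ _ => by
      rw [norm_norm]
      exact hM _ (by simp)
  rw [sub_zero, abs_of_pos Real.two_pi_pos] at h2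
  simp only [NNReal.coe_one, abs_one, inv_one, one_pow, mul_one] at h2 ⊢
  rw [inv_mul_le_iff₀ Real.two_pi_pos, mul_comm (2 * Real.pi)]
  exact (le_abs_self _).trans h2

/-- Cauchy's estimate for the generating function. Only values of `g` on one circle enter, so the
pairing can be controlled for `g = ψ · (u ∘ φ)` without controlling its norm. -/
theorem norm_inner_expPoly_le (U w : ℂ) (k : ℕ) {g : Fock} {K : ℝ}
    (hK : ∀ z, ‖z - conj U‖ = 1 → ‖g z‖ ≤ K) :
    ‖inner ℂ (expPoly U w k) g‖ ≤ k.factorial * (Real.exp ‖w‖ * K) := by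
  have hd := g.differentiable
  have h := norm_coeff_le_of_hasSum (by fun_prop) (hasSum_inner_expPoly U w g)
    (M := Real.exp ‖w‖ * K) (fun ε hε => ?_) k
  · rwa [norm_mul, norm_inv, norm_natCast, inv_mul_le_iff₀ (by positivity)] at h
  · rw [norm_mul]
    gcongr
    · rw [norm_exp]
      gcongr
      refine (re_le_norm _).trans_eq ?_
      rw [norm_neg, norm_mul, hε, one_mul, norm_conj]
    · exact hK _ (by simpa using hε)

theorem eq_zero_of_inner_expPoly (U w : ℂ) {g : Fock}
    (h : ∀ k, inner ℂ (expPoly U w k) g = 0) : g = 0 := by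
  ext z
  have h1 := hasSum_inner_expPoly U w g (z - conj U)
  simp only [h, mul_zero, zero_mul] at h1
  have h2 := h1.unique hasSum_zero
  rw [add_sub_cancel] at h2
  exact (mul_eq_zero.1 h2).resolve_left (Complex.exp_ne_zero _)

theorem dense_of_expPoly_mem (U w : ℂ) {K : Submodule ℂ Fock} (h : ∀ k, expPoly U w k ∈ K) :
    Dense (K : Set Fock) := by
  rw [Submodule.dense_iff_topologicalClosure_eq_top, Submodule.topologicalClosure_eq_top_iff,
    Submodule.eq_bot_iff]
  exact fun g hg => eq_zero_of_inner_expPoly U w fun k => (Submodule.mem_orthogonal K g).1 hg _ (h k)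

theorem Fock.exists_norm_le {s : Set ℂ} (hs : Bornology.IsBounded s) :
    ∃ M : ℝ, ∀ (f : Fock), ∀ z ∈ s, ‖f z‖ ≤ M * ‖f‖ := by
  obtain ⟨r, hr⟩ := hs.exists_norm_le
  refine ⟨Real.exp (r ^ 2 / 2), fun f z hz => (norm_apply_le f z).trans ?_⟩
  have := hr z hz
  gcongr

theorem mem_adjoint_domain_of_bound {H : Type*} [NormedAddCommGroup H] [InnerProductSpace ℂ H]
    [CompleteSpace H] {A : H →ₗ.[ℂ] H} {y : H} (M : ℝ) (h : ∀ u : A.domain, ‖inner ℂ y (A u)‖ ≤ M * ‖(u : H)‖) :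
    y ∈ A.adjoint.domain :=
  LinearPMap.mem_adjoint_domain_iff _ _ |>.2 (AddMonoidHomClass.continuous_of_bound _ M h)

variable {a b c : ℂ}

/-- Exponential polynomials are permuted by the conjugation up to scalars, so for a `C`-selfadjoint
operator their domain question becomes one about the adjoint, settled by a bound. -/
theorem wcConj_expPoly (h : ConjParam a b c) (U w : ℂ) (k : ℕ) :
    wcConj a b c h (expPoly U w k) =
      (c * exp (conj U * b) * a ^ k) • expPoly (b + a * conj U) (a⁻¹ * (conj w - b)) k := by
  have ha : a ≠ 0 := norm_ne_zero_iff.1 (by rw [h.norm_a]; exact one_ne_zero)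
  ext z
  change c * exp (b * z) * conj ((conj (a * z + b) - w) ^ k * exp (U * conj (a * z + b))) =
    c * exp (conj U * b) * a ^ k *
      ((z - a⁻¹ * (conj w - b)) ^ k * exp ((b + a * conj U) * z))
  have e1 : a ^ k * (z - a⁻¹ * (conj w - b)) ^ k = (a * z + b - conj w) ^ k := by
    rw [← mul_pow, mul_sub, mul_inv_cancel_left₀ ha]; ring
  have e2 : exp (conj U * b) * exp ((b + a * conj U) * z) =
      exp (b * z) * exp (conj U * (a * z + b)) := by
    rw [← Complex.exp_add, ← Complex.exp_add]; ring_nf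
  simp only [map_mul, map_pow, map_sub, ← exp_conj, conj_conj]
  rw [← e1]
  linear_combination -(c * a ^ k * (z - a⁻¹ * (conj w - b)) ^ k) * e2

/-- After conjugation, the pairing with `A u` is bounded by the size of `ψ · (u ∘ φ)` on a compact
circle: there `ψ` is bounded, and `u ∘ φ` is at most a multiple of `‖u‖`. -/
theorem expPoly_mem_domain (h : ConjParam a b c) {A : Fock →ₗ.[ℂ] Fock} {ψ φ : ℂ → ℂ}
    (hψ : Continuous ψ) (hφ : Continuous φ) (hA : A ≤ wcMax ψ φ)
    (hsa : IsCSelfAdjoint (wcConj a b c h) A) (U w : ℂ) (k : ℕ) : expPoly U w k ∈ A.domain := by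
  rw [hsa.2, Conjugation.mem_conjOp, wcConj_expPoly]
  refine Submodule.smul_mem _ _ ?_
  set V := b + a * conj U
  have hc : IsCompact (Metric.sphere (conj V) 1) := isCompact_sphere _ _
  obtain ⟨M, hM⟩ := Fock.exists_norm_le (hc.image hφ).isBounded
  obtain ⟨N, hN⟩ := (hc.image hψ).isBounded.exists_norm_le
  refine mem_adjoint_domain_of_bound
    (k.factorial * (Real.exp ‖a⁻¹ * (conj w - b)‖ * (N * M))) fun u => ?_
  refine (norm_inner_expPoly_le V _ k (K := N * M * ‖(u : Fock)‖) fun z hz => ?_).trans_eq (by ring)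
  have hz' : z ∈ Metric.sphere (conj V) 1 := by rwa [mem_sphere_iff_norm]
  have h1 := hN _ ⟨z, hz', rfl⟩
  rw [← opApply_of_mem u.2, opApply_wcMax_of_le hA u.2, norm_mul, mul_assoc]
  exact mul_le_mul h1 (hM u _ ⟨z, hz', rfl⟩) (norm_nonneg _) ((norm_nonneg _).trans h1)

end ExpPolynomials

/-! ### Joint eigenvectors, density, and failure of selfadjointness for `ℓ > 0`. -/

section Positive

variable {a b c ℓ G H : ℂ} {T : ℝ → Fock →ₗ.[ℂ] Fock}

/-- The flow fixes `G`, so `z - G` is scaled by `e^{ℓt}`; the exponent `aG + b` is the one for which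
the cocycle restores `e^{(aG + b)z}` up to a constant. -/
theorem wc_expPoly (k : ℕ) (t : ℝ) (z : ℂ) :
    semicocycle a b ℓ G H t z * expPoly (a * G + b) G k (semiflow ℓ G t z) =
      exp ((H - ℓ * (a * G + b) * G + k * ℓ) * t) * expPoly (a * G + b) G k z := by
  have e1 : semiflow ℓ G t z - G = exp (ℓ * t) * (z - G) := by
    simp only [semiflow]; ring
  have e2 : exp ((H - ℓ * (a * G + b) * G + k * ℓ) * t) =
      exp (ℓ * t) ^ k * exp ((H - ℓ * (a * G + b) * G) * t) := by
    rw [← Complex.exp_nat_mul, ← Complex.exp_add]; ring_nf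
  have e3 : semicocycle a b ℓ G H t z * exp ((a * G + b) * semiflow ℓ G t z) =
      exp ((H - ℓ * (a * G + b) * G) * t) * exp ((a * G + b) * z) := by
    simp only [semicocycle, semiflow]
    rw [← Complex.exp_add, ← Complex.exp_add, ← Complex.exp_add]
    ring_nf
  rw [expPoly_apply, expPoly_apply, e1, e2, mul_pow]
  linear_combination exp (ℓ * t) ^ k * (z - G) ^ k * e3

theorem genExpr_expPoly (k : ℕ) (z : ℂ) : genExpr a b ℓ G H (expPoly (a * G + b) G k) z =
    (H - ℓ * (a * G + b) * G + k * ℓ) * expPoly (a * G + b) G k z := by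
  have h1 : HasDerivAt (expPoly (a * G + b) G k)
      ((k * (z - G) ^ (k - 1) * 1) * exp ((a * G + b) * z) +
        (z - G) ^ k * (exp ((a * G + b) * z) * ((a * G + b) * 1))) z :=
    (((hasDerivAt_id z).sub_const G).pow k).mul ((hasDerivAt_id z).const_mul (a * G + b)).cexp
  have h4 : (k : ℂ) * (z - G) ^ (k - 1) * (z - G) = k * (z - G) ^ k := by
    rcases k with _ | n
    · simp
    · rw [Nat.add_sub_cancel, mul_assoc, ← pow_succ]
  rw [genExpr, h1.deriv, expPoly_apply]
  linear_combination ℓ * exp ((a * G + b) * z) * h4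

theorem continuous_semicocycle (t : ℝ) : Continuous (semicocycle a b ℓ G H t) := by
  unfold semicocycle; fun_prop

theorem continuous_semiflow (t : ℝ) : Continuous (semiflow ℓ G t) := by
  unfold semiflow; fun_prop

theorem expPoly_mem_sigmaSpace (h : ConjParam a b c)
    (hW : ∀ t : ℝ, 0 ≤ t → T t ≤ wcMax (semicocycle a b ℓ G H t) (semiflow ℓ G t))
    (hsa : ∀ t : ℝ, 0 ≤ t → IsCSelfAdjoint (wcConj a b c h) (T t)) (k : ℕ) :
    expPoly (a * G + b) G k ∈ sigmaSpace T (H - ℓ * (a * G + b) * G + k * ℓ).re := by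
  set e := expPoly (a * G + b) G k
  set η := H - ℓ * (a * G + b) * G + k * ℓ
  have hd : ∀ t : ℝ, 0 ≤ t → e ∈ (T t).domain := fun t ht =>
    expPoly_mem_domain h (continuous_semicocycle t) (continuous_semiflow t) (hW t ht) (hsa t ht) _ _ k
  have he : ∀ t : ℝ, 0 ≤ t → opApply (T t) e = exp (η * t) • e := fun t ht => by
    ext z
    rw [opApply_wcMax_of_le (hW t ht) (hd t ht), wc_expPoly, Fock.smul_apply]
  have hc : Continuous fun t : ℝ => exp (η * t) • e := by fun_prop
  refine mem_sigmaSpace_iff.2 ⟨⟨fun t s ht hs => ⟨hd s hs, ?_⟩, fun t s ht hs => ?_,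
    hc.continuousOn.congr fun t ht => he t (le_of_lt ht), ?_⟩, ‖e‖, fun t ht => ?_⟩
  · rw [he s hs]
    exact (T t).domain.smul_mem _ (hd t ht)
  · rw [he s hs, opApply_smul _ (hd t ht), he t ht, he _ (add_nonneg ht hs), smul_smul,
      ← Complex.exp_add]
    congr 2
    push_cast
    ring
  · rw [← tendsto_zero_iff_norm_tendsto_zero, ← sub_self e]
    refine Filter.Tendsto.sub_const ?_ _
    have h0 := (hc.tendsto 0).mono_left (nhdsWithin_le_nhds (s := Set.Ioi 0))
    simp only [ofReal_zero, mul_zero, Complex.exp_zero, one_smul] at h0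
    refine h0.congr' ?_
    filter_upwards [self_mem_nhdsWithin] with t ht
    exact (he t (le_of_lt ht)).symm
  · rw [he t ht, norm_smul, norm_exp, re_mul_ofReal, mul_comm]

theorem dense_genOp_domain (h : ConjParam a b c)
    (hW : ∀ t : ℝ, 0 ≤ t → T t ≤ wcMax (semicocycle a b ℓ G H t) (semiflow ℓ G t))
    (hsa : ∀ t : ℝ, 0 ≤ t → IsCSelfAdjoint (wcConj a b c h) (T t)) :
    Dense ((genOp a b ℓ G H T).domain : Set Fock) :=
  dense_of_expPoly_mem (a * G + b) G fun k => mem_genOp_domain.2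
    ⟨_, expPoly_mem_sigmaSpace h hW hsa k, (H - ℓ * (a * G + b) * G + k * ℓ) • _,
      sigmaSpace.smul _ (expPoly_mem_sigmaSpace h hW hsa k), fun z => (genExpr_expPoly k z).symm⟩

/-- Pairing with a kernel evaluates `genExpr u` at `conj U`; `u` and, by Cauchy's estimate, `u'` at
that point are bounded by multiples of `‖u‖`. -/
theorem kernel_mem_adjoint_genOp (U w : ℂ) :
    expPoly U w 0 ∈ (genOp a b ℓ G H T).adjoint.domain := by
  obtain ⟨M, hM⟩ := Fock.exists_norm_le (Metric.isBounded_sphere (x := conj U) (r := 1))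
  obtain ⟨N, hN⟩ := Fock.exists_norm_le (Bornology.isBounded_singleton (x := conj U))
  refine mem_adjoint_domain_of_bound
    (‖H - ℓ * (a * G + b) * conj U‖ * N + ‖ℓ * (conj U - G)‖ * M) fun u => ?_
  have h1 : ‖deriv (u : Fock) (conj U)‖ ≤ M * ‖(u : Fock)‖ / 1 :=
    norm_deriv_le_of_forall_mem_sphere_norm_le one_pos
      (u : Fock).differentiable.diffContOnCl fun z hz => hM u z hz
  rw [div_one] at h1
  rw [inner_expPoly_zero, genOp_apply, genExpr, add_mul]
  refine norm_add_le_of_le ?_ ?_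
  · rw [norm_mul, mul_assoc ‖_‖]
    gcongr
    exact hN u _ rfl
  · rw [norm_mul, mul_assoc ‖_‖]
    gcongr

/-- From `e^{rt} - 1 ≥ (rt)²/2` and `e^x ≥ 1 + x`, the bound would keep a quadratic with positive
leading coefficient below `M`. -/
theorem not_forall_exp_exp_le {p q r ω M : ℝ} (hq : 0 < q) (hr : 0 < r) :
    ¬ ∀ t : ℝ, 0 ≤ t → Real.exp (p * t + q * (Real.exp (r * t) - 1)) ≤ M * Real.exp (ω * t) := by
  intro h
  set A := q * r ^ 2 / 2 with hA
  have hA0 : 0 < A := by positivity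
  have h1 : ∀ t : ℝ, 0 ≤ t → A * t ^ 2 + (p - ω) * t ≤ M := fun t ht => by
    have h2 := Real.quadratic_le_exp_of_nonneg (mul_nonneg hr.le ht)
    have h3 : (A * t ^ 2 + (p - ω) * t) + ω * t ≤ p * t + q * (Real.exp (r * t) - 1) := by
      have h4 : (r * t) ^ 2 / 2 ≤ Real.exp (r * t) - 1 := by
        have := mul_nonneg hr.le ht
        linarith
      have h5 := mul_le_mul_of_nonneg_left h4 hq.le
      have h6 : q * ((r * t) ^ 2 / 2) = A * t ^ 2 := by rw [hA]; ring
      linarith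
    have h7 := (Real.exp_le_exp.2 h3).trans (h t ht)
    rw [Real.exp_add] at h7
    have h8 := le_of_mul_le_mul_right h7 (Real.exp_pos _)
    linarith [Real.add_one_le_exp (A * t ^ 2 + (p - ω) * t)]
  -- Chosen so that `t ≥ 1` and `A t + (p - ω) ≥ |M| + 1`, whose product exceeds `M`.
  set t := (|p - ω| + |M| + 1) / A + 1 with ht
  have ht1 : 1 ≤ t := by rw [ht]; linarith [show 0 ≤ (|p - ω| + |M| + 1) / A by positivity]
  have h2 : |p - ω| + |M| + 1 ≤ A * t := by
    rw [ht, mul_add, mul_div_cancel₀ _ hA0.ne']; linarith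
  have h3 : |M| + 1 ≤ A * t + (p - ω) := by linarith [neg_abs_le (p - ω)]
  have h4 := mul_le_mul ht1 h3 (by positivity) (by linarith)
  have h5 := h1 t (by linarith)
  have h6 : t * (A * t + (p - ω)) = A * t ^ 2 + (p - ω) * t := by ring
  linarith [le_abs_self M]

theorem one_notMem_sigmaSpace
    (hW : ∀ t : ℝ, 0 ≤ t → T t ≤ wcMax (semicocycle a b ℓ G H t) (semiflow ℓ G t))
    (hℓ : 0 < ℓ.re) (hℓ' : ℓ.im = 0) (hE : a * G + b ≠ 0) (ω : ℝ) :
    expPoly 0 0 0 ∉ sigmaSpace T ω := fun h1 => by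
  -- In the cocycle exponent `e^{ℓt}` has coefficient `(G - z)(aG + b)`; this `z` makes it `|aG +
  -- b|² > 0`.
  obtain ⟨M, hM⟩ := norm_wc_le hW h1 (G - conj (a * G + b))
  refine not_forall_exp_exp_le (p := (H - G * (a * G + b) * ℓ).re) (q := ‖a * G + b‖ ^ 2)
    (by positivity) hℓ fun t ht => le_of_eq_of_le ?_ (hM t ht)
  have e : semicocycle a b ℓ G H t (G - conj (a * G + b)) = exp
      ((H - G * (a * G + b) * ℓ) * t +
        ((‖a * G + b‖ ^ 2 * (Real.exp (ℓ.re * t) - 1) : ℝ) : ℂ)) := by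
    have hre : ((ℓ.re : ℝ) : ℂ) = ℓ := Complex.ext rfl hℓ'.symm
    rw [semicocycle, ← Complex.exp_add]
    push_cast
    rw [hre, ← mul_conj']
    ring_nf
  rw [expPoly_apply, e]
  simp only [pow_zero, zero_mul, Complex.exp_zero, mul_one, norm_exp, add_re, ofReal_re,
    re_mul_ofReal]

/-- The constant `1` is conjugated to a multiple of a kernel, which lies in `dom R*`;
selfadjointness would put `1` in `dom R`, hence in some `Σ_ω`, against its doubly exponential orbit.
-/
theorem not_isCSelfAdjoint_genOp (h : ConjParam a b c)
    (hW : ∀ t : ℝ, 0 ≤ t → T t ≤ wcMax (semicocycle a b ℓ G H t) (semiflow ℓ G t))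
    (hℓ : 0 < ℓ.re) (hℓ' : ℓ.im = 0) (hE : a * G + b ≠ 0) :
    ¬ IsCSelfAdjoint (wcConj a b c h) (genOp a b ℓ G H T) := fun hR => by
  have h1 : expPoly 0 0 0 ∈ (genOp a b ℓ G H T).domain := by
    rw [hR.2, Conjugation.mem_conjOp, wcConj_expPoly]
    exact Submodule.smul_mem _ _ (kernel_mem_adjoint_genOp _ _)
  obtain ⟨ω, h2, -⟩ := mem_genOp_domain.1 h1
  exact one_notMem_sigmaSpace hW hℓ hℓ' hE ω h2

end Positive

end CSym

theorem mainTheorem3 (a b c : ℂ) (habc : CSym.ConjParam a b c) (ℓ G H : ℂ) (hℓ : ℓ ≠ 0)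
    (T : ℝ → CSym.Fock →ₗ.[ℂ] CSym.Fock)
    (hW : ∀ t : ℝ, 0 ≤ t →
      T t ≤ CSym.wcMax (CSym.semicocycle a b ℓ G H t) (CSym.semiflow ℓ G t))
    (hT : CSym.IsUnboundedC0Semigroup T)
    (hsa : ∀ t : ℝ, 0 ≤ t → CSym.IsCSelfAdjoint (CSym.wcConj a b c habc) (T t)) :
    ∃ R : CSym.Fock →ₗ.[ℂ] CSym.Fock, CSym.IsGenerator T R ∧
      -- the domain and the action of the generator
      ((R.domain : Set CSym.Fock) =
          ⋃ ω : ℝ, {f | f ∈ CSym.sigmaSpace T ω ∧ ∃ g ∈ CSym.sigmaSpace T ω, ∀ z : ℂ,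
            g z = (H - ℓ * (a * G + b) * z) * f z + ℓ * (z - G) * deriv f z} ∧
        ∀ (f : R.domain) (z : ℂ), R f z =
          (H - ℓ * (a * G + b) * z) * (f : CSym.Fock) z +
            ℓ * (z - G) * deriv (f : CSym.Fock) z) ∧
      -- symmetry of the generator
      CSym.IsCSymmetric (CSym.wcConj a b c habc) R ∧
      -- the case of a real and positive `ℓ`; the adjoints of `R` and of all `T t` exist
      (0 < ℓ.re ∧ ℓ.im = 0 ∧ a * G + b ≠ 0 →
        Dense (R.domain : Set CSym.Fock) ∧
        ¬ CSym.IsCSelfAdjoint (CSym.wcConj a b c habc) R ∧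
        CSym.IsUnboundedC0Semigroup (fun t => (T t).adjoint) ∧
        (∃ B, CSym.IsGenerator (fun t => (T t).adjoint) B) ∧
        ¬ CSym.IsGenerator (fun t => (T t).adjoint) R.adjoint) ∧
      -- the point spectrum
      CSym.pointSpectrum R ⊆ {η | ∃ k : ℕ, η = H - ℓ * (a * G + b) * G + k * ℓ} := by
  have hadj : ∀ t : ℝ, 0 ≤ t → (T t).adjoint = (CSym.wcConj a b c habc).conjOp (T t) :=
    fun t ht => (hsa t ht).adjoint_eq
  have hR := CSym.isGenerator_genOp hW hsa
  refine ⟨CSym.genOp a b ℓ G H T, hR, ⟨rfl, fun f z => rfl⟩, CSym.isCSymmetric_genOp hW hsa,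
    fun ⟨hpos, him, hE⟩ => ?_, CSym.pointSpectrum_genOp⟩
  have hd := CSym.dense_genOp_domain habc hW hsa
  have hn := CSym.not_isCSelfAdjoint_genOp habc hW hpos him hE
  exact ⟨hd, hn, hT.map_conj hadj, ⟨_, hR.map_conj hadj⟩,
    CSym.not_isGenerator_adjoint hsa hR hd hn⟩
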